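/- Theorem 5.1. Let $\Xi$ be a probability distribution on a measurable space, let $f(x,\xi)$ be real-valued, and let $\omega:\mathbb R^n\to\mathbb R\cup\{+\infty\}$ be lower semicontinuous. Assume that $f(x)=\mathbb E_{\xi\sim\Xi}[f(x,\xi)]$ exists for $x\in\operatorname{dom}\omega$, and put $\psi=f+\omega$ and $\psi_{1/\rho}(x)=\min_z\{\psi(z)+\frac{\rho}{2}\|z-x\|^2\}$. Let $\kappa,\tau,L_\omega,\Lambda\ge 0$, $\rho>\kappa+\tau$, $\alpha>0$, $\sigma\in\mathbb R$, $\zeta\in(\frac12,1)$. Let $f_x(y,\xi)$ be a stochastic model function, jointly measurable in $(x,y,\xi)$, and $\mathsf{Lip}(x,\xi)\ge 0$ be jointly measurable in $(x,\xi)$. Assume: 1. $\omega+\frac{\kappa}{2}\|\cdot\|^2$ is convex and $\omega$ is $L_\omega$-Lipschitz on $\operatorname{dom}\omega$. 2. For all $x,y\in\operatorname{dom}\omega$: $f_x(y,\cdot)$ is $\Xi$-integrable, $\mathbb E_\xi[f_x(x,\xi)]=f(x)$ and $\mathbb E_\xi[f_x(y,\xi)]-f(y)\le\frac{\tau}{2}\|x-y\|^2$.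 For almost every $\xi$, $f_x(\cdot,\xi)$ is convex on $\operatorname{dom}\omega$ for every $x\in\operatorname{dom}\omega$. 3. (Reference Lipschitz continuity.) For almost every $\xi$ and every $x\in\operatorname{dom}\omega$, $f_x(\cdot,\xi)$ is Lipschitz on $\mathbb R^n$ with constant $\mathsf{Lip}(x,\xi)$. For every $x\in\operatorname{dom}\omega$, $\mathbb E_{\xi,\xi'}[|\mathsf{Lip}(x,\xi)-\mathsf{Lip}(x,\xi')|^2]\le\sigma^2$, where $\xi,\xi'\sim\Xi$ are independent. 4. There is a continuous non-decreasing (not necessarily known) growth function $\mathcal G:[0,\infty)\to[0,\infty)$ with $\mathbb E_\xi[\mathsf{Lip}(x,\xi)]\le\mathcal G(\|x\|)$ for all $x\in\operatorname{dom}\omega$. 5. $\psi_{1/\rho}\ge-\Lambda$ everywhere, and for every $v\in\mathbb R$ the level set $\{x:\psi_{1/\rho}(x)\le v\}$ is bounded. Let $\xi^1,\xi'^1,\xi^2,\xi'^2,\dots$ be independent samples from $\Xi$, let $x^1\in\operatorname{dom}\omega$ be deterministic, and for $k\ge1$ let, almost surely, $$x^{k+1}=\operatorname*{argmin}_x\Big\{f_{x^k}(x,\xi^k)+\omega(x)+\frac{\gamma_k}{2}\|x-x^k\|^2\Big\},\qquad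 \gamma_k=\rho+\kappa+\tau+\max\{\mathsf{Lip}(x^k,\xi'^k),\alpha\}\,k^\zeta,$$ where each $x^k$ is measurable with respect to the samples $\xi^j,\xi'^j$, $j<k$. Then $\psi_{1/\rho}$ is differentiable on $\mathbb R^n$, the sequence $\{\|x^k\|\}$ is bounded almost surely, and $\inf_{j\le k}\|\nabla\psi_{1/\rho}(x^j)\|\to0$ almost surely as $k\to\infty$. -/

import Mathlib

open MeasureTheory ProbabilityTheory Filter Topology
open scoped NNReal

namespace StochasticModel

section Deterministic

variable {E : Type*} [NormedAddCommGroup E] [InnerProductSpace ℝ E]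

/-- The effective domain of an extended-real-valued function. -/
def effDom (g : E → EReal) : Set E := {x | g x < ⊤}

/-- `c`-weak convexity of a function with values in `ℝ ∪ {+∞}`: `g + (c / 2) ‖·‖²` is convex, that is,
its effective domain is convex and it is a convex real function there. -/
def IsWeaklyConvex (c : ℝ) (g : E → EReal) : Prop :=
  (∀ x, g x ≠ ⊥) ∧ ConvexOn ℝ (effDom g) (fun x => (g x).toReal + c / 2 * ‖x‖ ^ 2)

/-- The Moreau envelope `g_{1/ρ}(x) = inf_y { g y + (ρ / 2) ‖x - y‖² }`, as an extended real
(no junk value when the infimum is infinite). -/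
noncomputable def moreauEnvelope (g : E → EReal) (ρ : ℝ) (x : E) : EReal :=
  ⨅ y, (g y + ((ρ / 2 * ‖x - y‖ ^ 2 : ℝ) : EReal))

/-- The Moreau envelope as a real function. -/
noncomputable def moreauReal (g : E → EReal) (ρ : ℝ) (x : E) : ℝ :=
  (moreauEnvelope g ρ x).toReal

/-- `x'` belongs to `argmin_y { q y + ω y + (γ / 2) ‖y - x‖² }`, the argmin being over the whole
space (points outside the effective domain of `ω` have the value `+∞`). -/
def IsProxStep (q : E → ℝ) (ω : E → EReal) (γ : ℝ) (x x' : E) : Prop :=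
  ∀ y, ((q x' + γ / 2 * ‖x' - x‖ ^ 2 : ℝ) : EReal) + ω x' ≤
    ((q y + γ / 2 * ‖y - x‖ ^ 2 : ℝ) : EReal) + ω y

end Deterministic

/-- A growth function: a continuous non-decreasing map from `[0, ∞)` to `[0, ∞)`. -/
def IsGrowthFunction (G : ℝ≥0 → ℝ≥0) : Prop := Continuous G ∧ Monotone G

section Stochastic

variable {E : Type*} [NormedAddCommGroup E] [InnerProductSpace ℝ E]
variable {S : Type*} [MeasurableSpace S]

/-- The objective `ψ x = 𝔼_ξ [f (x, ξ)] + ω x`, with values in `ℝ ∪ {+∞}`. -/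
noncomputable def objective (Ξ : Measure S) (F : E → S → ℝ) (ω : E → EReal) (x : E) : EReal :=
  ((∫ ξ, F x ξ ∂Ξ : ℝ) : EReal) + ω x

/-- The conditions on the stochastic model `m x y ξ = f_x (y, ξ)` of `f x = 𝔼_ξ [F x ξ]` over the
set `D`: unbiased at the anchor, a one-sided quadratic lower model on average, and convex. -/
structure IsStochasticModel (Ξ : Measure S) (F : E → S → ℝ) (D : Set E) (τ : ℝ)
    (m : E → E → S → ℝ) : Prop where
  integrable_obj : ∀ x ∈ D, Integrable (F x) Ξ
  integrable_model : ∀ x ∈ D, ∀ y ∈ D, Integrable (m x y) Ξ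
  unbiased : ∀ x ∈ D, ∫ ξ, m x x ξ ∂Ξ = ∫ ξ, F x ξ ∂Ξ
  lower : ∀ x ∈ D, ∀ y ∈ D,
    ∫ ξ, m x y ξ ∂Ξ - ∫ ξ, F y ξ ∂Ξ ≤ τ / 2 * ‖x - y‖ ^ 2
  convex : ∀ᵐ ξ ∂Ξ, ∀ x ∈ D, ConvexOn ℝ D (fun y => m x y ξ)

/-- Reference Lipschitz continuity over the set `D` of anchors, with noise parameter `σ`: the model
with anchor `x` is globally Lipschitz with constant `Lip x ξ`, and
`𝔼_{ξ, ξ'} [|Lip x ξ - Lip x ξ'|²] ≤ σ²` for independent samples `ξ`, `ξ'`. -/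
structure IsReferenceLipschitz (Ξ : Measure S) (D : Set E) (m : E → E → S → ℝ)
    (Lip : E → S → ℝ≥0) (σ : ℝ) : Prop where
  lipschitz : ∀ᵐ ξ ∂Ξ, ∀ x ∈ D, LipschitzWith (Lip x ξ) (fun y => m x y ξ)
  integrable : ∀ x ∈ D,
    Integrable (fun p : S × S => |(Lip x p.1 : ℝ) - (Lip x p.2 : ℝ)| ^ 2) (Ξ.prod Ξ)
  noise : ∀ x ∈ D,
    ∫ p : S × S, |(Lip x p.1 : ℝ) - (Lip x p.2 : ℝ)| ^ 2 ∂(Ξ.prod Ξ) ≤ σ ^ 2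

/-- The σ-algebra generated by the samples drawn before iteration `k`. -/
abbrev pastSigma {Ω : Type*} (ξ ξ' : ℕ → Ω → S) (k : ℕ) : MeasurableSpace Ω :=
  ⨆ j : Set.Iio k, MeasurableSpace.comap (ξ j) inferInstance ⊔
    MeasurableSpace.comap (ξ' j) inferInstance

variable {Ω : Type*} [MeasurableSpace Ω]

/-- The two sequences of samples `ξ k`, `ξ' k` are all mutually independent with law `Ξ`. -/
structure IsSampling (P : Measure Ω) (Ξ : Measure S) (ξ ξ' : ℕ → Ω → S) : Prop where
  measurable : ∀ k, Measurable (ξ k)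
  measurable' : ∀ k, Measurable (ξ' k)
  law : ∀ k, P.map (ξ k) = Ξ
  law' : ∀ k, P.map (ξ' k) = Ξ
  indep : iIndepFun (Sum.elim ξ ξ') P

variable [MeasurableSpace E]

/-- The iterates of stochastic model-based optimization with regularization weights `γ`, started at
`x₁`. Indices are shifted by one: `x k`, `ξ k`, `γ k` stand for the iterate, the sample and the
weight of iteration `k + 1`. Each iterate depends measurably on the samples drawn before. -/
structure IsModelBasedRun (P : Measure Ω) (m : E → E → S → ℝ) (ω : E → EReal)
    (ξ ξ' : ℕ → Ω → S) (γ : ℕ → Ω → ℝ) (x₁ : E) (x : ℕ → Ω → E) : Prop where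
  init : ∀ w, x 0 w = x₁
  adapted : ∀ k, Measurable[pastSigma ξ ξ' k] (x k)
  step : ∀ᵐ w ∂P, ∀ k,
    IsProxStep (fun y => m (x k w) y (ξ k w)) ω (γ k w) (x k w) (x (k + 1) w)

end Stochastic

end StochasticModel

/-! The Moreau envelope `φ` of `ψ` serves as a Lyapunov function. The averaged models make `f`
`τ`-weakly convex, so `ψ` is `(κ + τ)`-weakly convex. Since `ρ > κ + τ`, the proximal map `p` is
Lipschitz and `φ` is differentiable with gradient `ρ (x - p x)` (`IsProxMap.hasGradientAt`). Both
conclusions therefore concern `φ (x k)` and the residuals `r = ‖p x - x‖`.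

For one step from `x` to `x'`, strong convexity of the model problem compares `x'` with `p x`, and
`p x` is a competitor in the proximal problem at `x'` (`envelope_step_le`). In expectation over the
two fresh samples, `φ` drops by at least `ρ (ρ - κ - τ) r² / M`, with `M` of order `k ^ ζ` times a
function of `‖x‖`, up to an error of order `k ^ (-2ζ)` (`lintegral_stepBound_le`). The error
constant does not depend on `x`: the Lipschitz constant of the model is divided by an independent
copy of itself, and their quotient is controlled by the noise `σ` alone (`stepError_pointwise`). No
a priori bound on the iterates is needed.

As `2ζ > 1`, the errors are summable and the Robbins-Siegmund theorem applies: almost surely `φ (x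
k)` stays bounded and the drops are summable. Bounded level sets then bound the iterates, hence the
growth function along the path, so that `∑ r² / k ^ ζ` converges. Since `ζ ≤ 1`, the residuals
cannot stay away from zero. -/

namespace StochasticModel

/-! ### Strong and weak convexity -/

section StrongConvexity

variable {E : Type*} [NormedAddCommGroup E] [InnerProductSpace ℝ E]

lemma strongConvexOn_norm_sub_sq (γ : ℝ) (x : E) {D : Set E} (hD : Convex ℝ D) :
    StrongConvexOn D γ (fun y => γ / 2 * ‖y - x‖ ^ 2) := by
  rw [strongConvexOn_iff_convex]
  have h : (fun y : E => γ / 2 * ‖y - x‖ ^ 2 - γ / 2 * ‖y‖ ^ 2)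
      = fun y => (-γ) * inner ℝ x y + γ / 2 * ‖x‖ ^ 2 := by
    funext y
    rw [norm_sub_sq_real, real_inner_comm]
    ring
  rw [h]
  refine ⟨hD, fun y _ z _ a b _ _ hab => le_of_eq ?_⟩
  simp only [inner_add_right, inner_smul_right, smul_eq_mul]
  have hb : b = 1 - a := by linarith
  subst hb
  ring

/-- The moduli carry no sign condition. Weak convexity is recorded throughout as a negative modulus,
and this lemma lets a quadratic term compensate for it. -/
lemma strongConvexOn_add {D : Set E} {c d : ℝ} {f g : E → ℝ} (hf : StrongConvexOn D c f)
    (hg : StrongConvexOn D d g) : StrongConvexOn D (c + d) (fun y => f y + g y) := by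
  have h := UniformConvexOn.add hf hg
  refine ⟨h.1, fun x hx y hy a b ha hb hab => (h.2 hx hy ha hb hab).trans (le_of_eq ?_)⟩
  simp only [Pi.add_apply, smul_eq_mul]
  ring

/-- Quadratic growth of a strongly convex function around a minimizer. -/
lemma StrongConvexOn.quadratic_growth {D : Set E} {c : ℝ} {H : E → ℝ} (hH : StrongConvexOn D c H)
    {p : E} (hp : p ∈ D) (hmin : ∀ y ∈ D, H p ≤ H y) {y : E} (hy : y ∈ D) :
    H p + c / 2 * ‖y - p‖ ^ 2 ≤ H y := by
  -- Strong convexity is used at the point `(1 - t) p + t y`; dividing by `t` leaves a factor `1 -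
  -- t`, removed by letting `t → 0`.
  have key : ∀ t ∈ Set.Ioo (0 : ℝ) 1, H p + (1 - t) * (c / 2 * ‖y - p‖ ^ 2) ≤ H y := by
    rintro t ⟨ht0, ht1⟩
    have h1 := hH.2 hp hy (sub_nonneg.2 ht1.le) ht0.le (by ring)
    have h2 := hmin _ (hH.1 hp hy (sub_nonneg.2 ht1.le) ht0.le (by ring))
    simp only [smul_eq_mul] at h1
    rw [norm_sub_rev p y] at h1
    have h3 : t * (H p + (1 - t) * (c / 2 * ‖y - p‖ ^ 2)) ≤ t * H y := by linarith
    exact le_of_mul_le_mul_left h3 ht0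
  have hlim : Tendsto (fun t : ℝ => H p + (1 - t) * (c / 2 * ‖y - p‖ ^ 2)) (𝓝[>] 0)
      (𝓝 (H p + (1 - 0) * (c / 2 * ‖y - p‖ ^ 2))) :=
    ((by fun_prop : Continuous fun t : ℝ =>
      H p + (1 - t) * (c / 2 * ‖y - p‖ ^ 2)).tendsto 0).mono_left nhdsWithin_le_nhds
  have := le_of_tendsto hlim (by
    filter_upwards [Ioo_mem_nhdsGT (zero_lt_one' ℝ)] with t ht using key t ht)
  simpa using this

/-- The proximal objective grows quadratically around its minimizer. -/
lemma prox_growth {D : Set E} {c γ : ℝ} {h : E → ℝ} (hh : StrongConvexOn D c h) {x p : E}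
    (hp : p ∈ D) (hmin : ∀ y ∈ D, h p + γ / 2 * ‖p - x‖ ^ 2 ≤ h y + γ / 2 * ‖y - x‖ ^ 2)
    {y : E} (hy : y ∈ D) :
    h p + γ / 2 * ‖p - x‖ ^ 2 + (c + γ) / 2 * ‖y - p‖ ^ 2 ≤ h y + γ / 2 * ‖y - x‖ ^ 2 :=
  StrongConvexOn.quadratic_growth (strongConvexOn_add hh (strongConvexOn_norm_sub_sq γ x hh.1))
    hp hmin hy

/-- A function with convex models that are exact at the anchor and below it up to
`τ / 2 * ‖x - y‖ ^ 2` is `τ`-weakly convex. -/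
lemma strongConvexOn_of_models {D : Set E} (hD : Convex ℝ D) {τ : ℝ} {f : E → ℝ} {q : E → E → ℝ}
    (hq : ∀ x ∈ D, ConvexOn ℝ D (q x)) (hqx : ∀ x ∈ D, q x x = f x)
    (hle : ∀ x ∈ D, ∀ y ∈ D, q x y - f y ≤ τ / 2 * ‖x - y‖ ^ 2) :
    StrongConvexOn D (-τ) f := by
  refine ⟨hD, fun x hx y hy a b ha hb hab => ?_⟩
  -- Anchoring the model at the convex combination itself makes it exact there. The errors at the
  -- endpoints average to the required term because `a * b ^ 2 + b * a ^ 2 = a * b`.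
  set z := a • x + b • y with hz
  have hzD : z ∈ D := hD hx hy ha hb hab
  have h1 := (hq z hzD).2 hx hy ha hb hab
  rw [← hz, hqx z hzD] at h1
  have hbe : b = 1 - a := by linarith
  have e1 : ‖z - x‖ = b * ‖x - y‖ := by
    have : z - x = b • (y - x) := by rw [hz, hbe]; module
    rw [this, norm_smul, Real.norm_of_nonneg hb, norm_sub_rev]
  have e2 : ‖z - y‖ = a * ‖x - y‖ := by
    have : z - y = a • (x - y) := by rw [hz, hbe]; module
    rw [this, norm_smul, Real.norm_of_nonneg ha]
  have h2 := mul_le_mul_of_nonneg_left (hle z hzD x hx) ha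
  have h3 := mul_le_mul_of_nonneg_left (hle z hzD y hy) hb
  rw [e1] at h2
  rw [e2] at h3
  simp only [smul_eq_mul] at h1 ⊢
  have e3 : a * (τ / 2 * (b * ‖x - y‖) ^ 2) + b * (τ / 2 * (a * ‖x - y‖) ^ 2)
      = a * b * (τ / 2 * ‖x - y‖ ^ 2) := by
    rw [hbe]; ring
  linarith

end StrongConvexity

/-! ### The proximal map and the gradient of the envelope -/

section Moreau

variable {E : Type*} [NormedAddCommGroup E]

/-- `p` selects minimizers of the proximal problems of `h` over `D`. -/
def IsProxMap (D : Set E) (h : E → ℝ) (ρ : ℝ) (p : E → E) : Prop :=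
  ∀ x, p x ∈ D ∧ ∀ y ∈ D, h (p x) + ρ / 2 * ‖p x - x‖ ^ 2 ≤ h y + ρ / 2 * ‖y - x‖ ^ 2

/-- Proximal minimizers exist for continuous functions that are bounded below. -/
lemma exists_isProxMap [ProperSpace E] {D : Set E} (hDc : IsClosed D) (hne : D.Nonempty)
    {h : E → ℝ} (hcont : ContinuousOn h D) {B : ℝ} (hB : ∀ y ∈ D, B ≤ h y) {ρ : ℝ} (hρ : 0 < ρ) :
    ∃ p, IsProxMap D h ρ p := by
  have : ∀ x, ∃ p, p ∈ D ∧
      ∀ y ∈ D, h p + ρ / 2 * ‖p - x‖ ^ 2 ≤ h y + ρ / 2 * ‖y - x‖ ^ 2 := by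
    intro x
    obtain ⟨y₀, hy₀⟩ := hne
    have hc : ContinuousOn (fun y => h y + ρ / 2 * ‖y - x‖ ^ 2) D :=
      hcont.add (by fun_prop)
    obtain ⟨p, hp, hpm⟩ := hc.exists_isMinOn' hDc hy₀ (by
      have h1 : Tendsto (fun y : E => ‖y - x‖) (cocompact E) atTop := by
        have := tendsto_dist_right_cocompact_atTop x
        simpa only [dist_eq_norm] using this
      have h2 : Tendsto (fun y : E => B + ρ / 2 * ‖y - x‖ ^ 2) (cocompact E) atTop := by
        refine tendsto_atTop_add_const_left _ _ (Tendsto.const_mul_atTop (by positivity) ?_)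
        exact (tendsto_pow_atTop two_ne_zero).comp h1
      have h3 := h2.eventually_ge_atTop (h y₀ + ρ / 2 * ‖y₀ - x‖ ^ 2)
      filter_upwards [h3.filter_mono inf_le_left, mem_inf_of_right (mem_principal_self D)]
        with y hy hyD
      exact hy.trans (by linarith [hB y hyD]))
    exact ⟨p, hp, fun y hy => hpm hy⟩
  choose p hp using this
  exact ⟨p, hp⟩

variable [InnerProductSpace ℝ E] {D : Set E} {h : E → ℝ} {ρ c : ℝ} {p : E → E}

/-- Adding the growth inequalities at the two minimizers, each tested with the other, cancels `h`.
The quadratic terms leave an inner product, to which Cauchy-Schwarz applies. -/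
lemma IsProxMap.norm_sub_le (hp : IsProxMap D h ρ p) (hh : StrongConvexOn D c h) (hc : 0 < c + ρ)
    (hρ : 0 ≤ ρ) (x y : E) : ‖p y - p x‖ ≤ ρ / (c + ρ) * ‖y - x‖ := by
  have h1 := prox_growth hh (hp x).1 (hp x).2 (hp y).1
  have h2 := prox_growth hh (hp y).1 (hp y).2 (hp x).1
  rw [norm_sub_rev (p x) (p y)] at h2
  have e : ρ / 2 * ‖p y - x‖ ^ 2 - ρ / 2 * ‖p x - x‖ ^ 2 + (ρ / 2 * ‖p x - y‖ ^ 2 -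
      ρ / 2 * ‖p y - y‖ ^ 2) = ρ * inner ℝ (p y - p x) (y - x) := by
    simp only [norm_sub_sq_real, inner_sub_left, inner_sub_right]
    ring
  have h3 : (c + ρ) * ‖p y - p x‖ ^ 2 ≤ ρ * (‖p y - p x‖ * ‖y - x‖) := by
    have := mul_le_mul_of_nonneg_left (real_inner_le_norm (p y - p x) (y - x)) hρ
    linarith
  rw [div_mul_eq_mul_div, le_div_iff₀ hc]
  rcases (norm_nonneg (p y - p x)).eq_or_lt with h0 | h0
  · rw [← h0]
    simpa using mul_nonneg hρ (norm_nonneg (y - x))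
  · refine le_of_mul_le_mul_left ?_ h0
    linarith

lemma IsProxMap.continuous (hp : IsProxMap D h ρ p) (hh : StrongConvexOn D c h) (hc : 0 < c + ρ)
    (hρ : 0 ≤ ρ) : Continuous p := by
  have : LipschitzWith (Real.toNNReal (ρ / (c + ρ))) p := by
    refine LipschitzWith.of_dist_le_mul fun x y => ?_
    rw [dist_eq_norm, dist_eq_norm, Real.coe_toNNReal _ (by positivity)]
    exact hp.norm_sub_le hh hc hρ y x
  exact this.continuous

/-- The envelope `x ↦ h (p x) + ρ / 2 * ‖p x - x‖ ^ 2` has gradient `ρ (x - p x)`. -/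
lemma IsProxMap.hasGradientAt [CompleteSpace E] (hp : IsProxMap D h ρ p)
    (hh : StrongConvexOn D c h) (hc : 0 < c + ρ) (hρ : 0 ≤ ρ) (x : E) :
    HasGradientAt (fun x => h (p x) + ρ / 2 * ‖p x - x‖ ^ 2) (ρ • (x - p x)) x := by
  rw [hasGradientAt_iff_isLittleO]
  -- Testing the problem at `y` with `p x` bounds the increment from above; testing the problem at
  -- `x` with `p y` bounds it from below. The second bound costs the term `ρ ⟪p y - p x, y - x⟫`,
  -- quadratic because `p` is Lipschitz.
  have hO : (fun y => h (p y) + ρ / 2 * ‖p y - y‖ ^ 2 - (h (p x) + ρ / 2 * ‖p x - x‖ ^ 2)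
      - inner ℝ (ρ • (x - p x)) (y - x)) =O[𝓝 x] fun y => ‖y - x‖ ^ 2 := by
    refine Asymptotics.IsBigO.of_bound (ρ / 2 + ρ * (ρ / (c + ρ))) (Eventually.of_forall fun y => ?_)
    have h1 := (hp y).2 _ (hp x).1
    have h2 := (hp x).2 _ (hp y).1
    have e1 : ρ / 2 * ‖p x - y‖ ^ 2 - ρ / 2 * ‖p x - x‖ ^ 2
        = inner ℝ (ρ • (x - p x)) (y - x) + ρ / 2 * ‖y - x‖ ^ 2 := by
      have : p x - y = (p x - x) - (y - x) := by abel
      rw [this, norm_sub_sq_real, real_inner_smul_left, ← neg_sub (p x) x, inner_neg_left]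
      ring
    have e2 : ρ / 2 * ‖p y - y‖ ^ 2 - ρ / 2 * ‖p y - x‖ ^ 2
        = inner ℝ (ρ • (x - p x)) (y - x) - ρ * inner ℝ (p y - p x) (y - x)
          + ρ / 2 * ‖y - x‖ ^ 2 := by
      have h1 : p y - y = (p y - x) - (y - x) := by abel
      have h2 : inner ℝ (x - p x) (y - x)
          = inner ℝ (p y - p x) (y - x) - inner ℝ (p y - x) (y - x) := by
        rw [← inner_sub_left, sub_sub_sub_cancel_left]
      rw [h1, norm_sub_sq_real, real_inner_smul_left, h2]
      ring
    have h3 : ρ * inner ℝ (p y - p x) (y - x) ≤ ρ * (ρ / (c + ρ)) * ‖y - x‖ ^ 2 := by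
      rw [mul_assoc]
      refine mul_le_mul_of_nonneg_left ((real_inner_le_norm _ _).trans ?_) hρ
      rw [sq, ← mul_assoc]
      exact mul_le_mul_of_nonneg_right (hp.norm_sub_le hh hc hρ x y) (norm_nonneg _)
    have h4 : 0 ≤ ρ * (ρ / (c + ρ)) * ‖y - x‖ ^ 2 := by positivity
    have h5 : 0 ≤ ρ / 2 * ‖y - x‖ ^ 2 := by positivity
    rw [Real.norm_eq_abs, norm_pow, norm_norm, abs_le, add_mul]
    constructor <;> linarith
  refine hO.trans_isLittleO ?_
  have := Asymptotics.isLittleO_pow_sub_sub x (one_lt_two)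
  exact this

end Moreau

end StochasticModel

namespace StochasticModel

/-! ### From extended-real values to real functions on the effective domain -/

section Bridge

variable {E : Type*}

lemma coe_toReal_of_mem_effDom {ω : E → EReal} (hbot : ∀ x, ω x ≠ ⊥) {y : E}
    (hy : y ∈ effDom ω) : ((ω y).toReal : EReal) = ω y :=
  EReal.coe_toReal (ne_of_lt hy) (hbot y)

lemma eq_top_of_notMem_effDom {ω : E → EReal} {y : E} (hy : y ∉ effDom ω) : ω y = ⊤ := by
  simpa [effDom] using hy

/-- Near a point where `ω = ⊤`, lower semicontinuity pushes `ω` above any bound, whereas the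
Lipschitz condition keeps it bounded on nearby points of the domain. Closedness is needed for
proximal minimizers to exist. -/
lemma isClosed_effDom [NormedAddCommGroup E] {ω : E → EReal} (hlsc : LowerSemicontinuous ω) (hbot : ∀ x, ω x ≠ ⊥)
    {L : ℝ≥0} (hlip : LipschitzOnWith L (fun x => (ω x).toReal) (effDom ω)) :
    IsClosed (effDom ω) := by
  refine isClosed_of_closure_subset fun x hx => ?_
  by_contra hxD
  obtain ⟨y₀, hy₀, hd₀⟩ := Metric.mem_closure_iff.1 hx 1 one_pos
  -- The factor `2` bounds the distance between two points of the domain that both lie within `1` of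
  -- `x`.
  have hT : ((((ω y₀).toReal + L * 2 : ℝ)) : EReal) < ω x := by
    rw [eq_top_of_notMem_effDom hxD]
    exact EReal.coe_lt_top _
  obtain ⟨δ, hδ, hball⟩ := Metric.eventually_nhds_iff.1 (hlsc x _ hT)
  obtain ⟨y, hy, hd⟩ := Metric.mem_closure_iff.1 hx (min δ 1) (lt_min hδ one_pos)
  have h1 : (((ω y₀).toReal + L * 2 : ℝ) : EReal) < ω y := hball (by rw [dist_comm]; exact hd.trans_le (min_le_left _ _))
  rw [← coe_toReal_of_mem_effDom hbot hy, EReal.coe_lt_coe_iff] at h1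
  have h2 := hlip.dist_le_mul y hy y₀ hy₀
  have h3 : dist y y₀ ≤ 2 := by
    have := dist_triangle_left y y₀ x
    linarith [hd.trans_le (min_le_right _ _)]
  have h4 := (le_abs_self _).trans h2
  have h5 := mul_le_mul_of_nonneg_left h3 L.2
  simp only [NNReal.val_eq_coe] at h5
  linarith

lemma objective_eq_coe {S : Type*} [MeasurableSpace S] {Ξ : Measure S} {F : E → S → ℝ}
    {ω : E → EReal} (hbot : ∀ x, ω x ≠ ⊥) {y : E} (hy : y ∈ effDom ω) :
    objective Ξ F ω y = ((∫ ξ, F y ξ ∂Ξ + (ω y).toReal : ℝ) : EReal) := by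
  rw [objective, EReal.coe_add, coe_toReal_of_mem_effDom hbot hy]

lemma objective_eq_top {S : Type*} [MeasurableSpace S] {Ξ : Measure S} {F : E → S → ℝ}
    {ω : E → EReal} {y : E} (hy : y ∉ effDom ω) : objective Ξ F ω y = ⊤ := by
  rw [objective, eq_top_of_notMem_effDom hy, EReal.coe_add_top]

variable [NormedAddCommGroup E]

/-- The infimum is attained at `p x`, hence finite, so passing to `moreauReal` loses nothing. -/
lemma moreauEnvelope_eq {D : Set E} {g : E → EReal} {h : E → ℝ} {ρ : ℝ} {p : E → E}
    (hgD : ∀ y ∈ D, g y = (h y : EReal)) (hgt : ∀ y ∉ D, g y = ⊤) (hp : IsProxMap D h ρ p)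
    (x : E) : moreauEnvelope g ρ x = ((h (p x) + ρ / 2 * ‖p x - x‖ ^ 2 : ℝ) : EReal) := by
  refine le_antisymm ((iInf_le _ (p x)).trans ?_) (le_iInf fun y => ?_)
  · rw [hgD _ (hp x).1, ← EReal.coe_add, norm_sub_rev]
  · by_cases hy : y ∈ D
    · rw [hgD _ hy, ← EReal.coe_add, EReal.coe_le_coe_iff, norm_sub_rev x y]
      exact (hp x).2 y hy
    · rw [hgt _ hy, EReal.top_add_coe]
      exact le_top

lemma moreauEnvelope_le_self (g : E → EReal) (ρ : ℝ) (x : E) : moreauEnvelope g ρ x ≤ g x := by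
  refine (iInf_le _ x).trans (le_of_eq ?_)
  simp

lemma IsProxStep.mem_effDom {q : E → ℝ} {ω : E → EReal} {γ : ℝ} {x x' y : E}
    (hs : IsProxStep q ω γ x x') (hbot : ∀ x, ω x ≠ ⊥) (hy : y ∈ effDom ω) : x' ∈ effDom ω := by
  by_contra hx'
  have h := hs y
  rw [eq_top_of_notMem_effDom hx', EReal.coe_add_top, ← coe_toReal_of_mem_effDom hbot hy,
    ← EReal.coe_add, top_le_iff] at h
  exact EReal.coe_ne_top _ h

lemma IsProxStep.le {q : E → ℝ} {ω : E → EReal} {γ : ℝ} {x x' : E}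
    (hs : IsProxStep q ω γ x x') (hbot : ∀ x, ω x ≠ ⊥) {y : E} (hy : y ∈ effDom ω) :
    q x' + (ω x').toReal + γ / 2 * ‖x' - x‖ ^ 2 ≤ q y + (ω y).toReal + γ / 2 * ‖y - x‖ ^ 2 := by
  have h := hs y
  rw [← coe_toReal_of_mem_effDom hbot hy, ← coe_toReal_of_mem_effDom hbot
    (hs.mem_effDom hbot hy), ← EReal.coe_add, ← EReal.coe_add, EReal.coe_le_coe_iff] at h
  linarith

end Bridge

/-! ### Pathwise estimate for one step -/

section Step

/-- The upper bound on `(γ - κ) / 2 * ‖p - x'‖ ^ 2` after a model step from `x` to `x'`, where `p`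
is a proximal point at distance `r` and `δ` is the increment of the model from `x` to `p`. -/
noncomputable def stepBound (γ r δ L : ℝ) : ℝ := γ / 2 * r ^ 2 + δ + L ^ 2 / (2 * γ)

/-- By completing the square. It ensures that `ENNReal.ofReal` truncates nothing when the bound is
integrated. -/
lemma stepBound_nonneg {γ r δ L : ℝ} (hγ : 0 < γ) (hδ : -(L * r) ≤ δ) :
    0 ≤ stepBound γ r δ L := by
  have h : γ / 2 * r ^ 2 - L * r + L ^ 2 / (2 * γ) = γ / 2 * (r - L / γ) ^ 2 := by
    field_simp
    ring
  have h2 : 0 ≤ γ / 2 * (r - L / γ) ^ 2 := by positivity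
  unfold stepBound
  linarith

variable {E : Type*} [NormedAddCommGroup E]

lemma le_add_mul_norm_of_lipschitzOn {D : Set E} {f : E → ℝ} {L : ℝ≥0} (hf : LipschitzOnWith L f D)
    {x y : E} (hx : x ∈ D) (hy : y ∈ D) : f x ≤ f y + L * ‖y - x‖ := by
  have h := (le_abs_self _).trans (hf.dist_le_mul x hx y hy)
  rw [dist_eq_norm, norm_sub_rev] at h
  linarith

/-- One step of the model-based method, measured by the envelope. -/
lemma envelope_step_le [InnerProductSpace ℝ E] {D : Set E} {h w q : E → ℝ} {ρ κ γ : ℝ} {p : E → E} {Lω L : ℝ≥0}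
    (hp : IsProxMap D h ρ p) (hρ : 0 ≤ ρ) (hκγ : κ < γ) (hγ : 0 < γ)
    (hw : StrongConvexOn D (-κ) w) (hwL : LipschitzOnWith Lω w D)
    (hq : ConvexOn ℝ D q) (hqL : LipschitzWith L q) {x x' : E} (hx : x ∈ D) (hx' : x' ∈ D)
    (hmin : ∀ y ∈ D, q x' + w x' + γ / 2 * ‖x' - x‖ ^ 2 ≤ q y + w y + γ / 2 * ‖y - x‖ ^ 2) :
    h (p x') + ρ / 2 * ‖p x' - x'‖ ^ 2 ≤ h (p x) + ρ / (γ - κ) *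
      stepBound γ ‖p x - x‖ (q (p x) - q x + (w (p x) - w x)) (L + Lω) := by
  have hqw : StrongConvexOn D (-κ) (fun y => q y + w y) := by
    have := strongConvexOn_add (strongConvexOn_zero.2 hq) hw
    rwa [zero_add] at this
  have h1 := prox_growth hqw hx' hmin (hp x).1
  have h2 := le_add_mul_norm_of_lipschitzOn (hqL.lipschitzOnWith (s := D)) hx hx'
  have h3 := le_add_mul_norm_of_lipschitzOn hwL hx hx'
  -- The Lipschitz loss between `x` and `x'` is absorbed by the proximal term of the step.
  have h4 : (L + Lω : ℝ) * ‖x' - x‖ ≤ γ / 2 * ‖x' - x‖ ^ 2 + (L + Lω : ℝ) ^ 2 / (2 * γ) := by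
    have e : γ / 2 * ‖x' - x‖ ^ 2 + (L + Lω : ℝ) ^ 2 / (2 * γ) - (L + Lω : ℝ) * ‖x' - x‖
        = γ / 2 * (‖x' - x‖ - (L + Lω) / γ) ^ 2 := by
      field_simp
      ring
    have e2 : 0 ≤ γ / 2 * (‖x' - x‖ - (L + Lω : ℝ) / γ) ^ 2 := by positivity
    linarith
  have h5 : (γ - κ) / 2 * ‖p x - x'‖ ^ 2 ≤
      stepBound γ ‖p x - x‖ (q (p x) - q x + (w (p x) - w x)) (L + Lω) := by
    unfold stepBound
    linarith
  -- The point `p x` is a competitor in the proximal problem at `x'`.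
  refine ((hp x').2 _ (hp x).1).trans (add_le_add le_rfl ?_)
  have h6 : 0 < γ - κ := sub_pos.2 hκγ
  calc ρ / 2 * ‖p x - x'‖ ^ 2 = ρ / (γ - κ) * ((γ - κ) / 2 * ‖p x - x'‖ ^ 2) := by
        field_simp
    _ ≤ _ := mul_le_mul_of_nonneg_left h5 (by positivity)

end Step

end StochasticModel

namespace StochasticModel

/-! ### Expected estimate for one step at a fixed anchor -/

section Expectation

variable {S : Type*} [MeasurableSpace S] {Ξ : Measure S} [IsProbabilityMeasure Ξ]

/-- If two independent copies differ by a square-integrable function, each of them is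
square-integrable. -/
lemma memLp_two_of_integrable_sub_sq {L : S → ℝ} (hL : Measurable L)
    (h : Integrable (fun p : S × S => |L p.1 - L p.2| ^ 2) (Ξ.prod Ξ)) : MemLp L 2 Ξ := by
  -- By Fubini, some value `b` of the second copy can be frozen; then `L` differs from a
  -- square-integrable function by the constant `L b`.
  obtain ⟨b, hb⟩ := h.prod_left_ae.exists
  have h1 : MemLp (fun a => L a - L b) 2 Ξ := by
    rw [memLp_two_iff_integrable_sq (hL.sub_const _).aestronglyMeasurable]
    simpa only [sq_abs] using hb
  have h2 := h1.add (memLp_const (L b))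
  refine (memLp_congr_ae (Eventually.of_forall fun a => ?_)).1 h2
  simp

/-- Jensen's inequality for the reciprocal. -/
lemma inv_le_integral_inv {v : S → ℝ} (hv : ∀ b, 0 < v b) (hvi : Integrable v Ξ)
    (hui : Integrable (fun b => (v b)⁻¹) Ξ) {M : ℝ} (hM : 0 < M) (hvM : ∫ b, v b ∂Ξ ≤ M) :
    M⁻¹ ≤ ∫ b, (v b)⁻¹ ∂Ξ := by
  -- The tangent line of `v ↦ 1 / v` at `M` lies below the graph.
  have h1 : ∀ b, 2 / M - v b / M ^ 2 ≤ (v b)⁻¹ := fun b => by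
    have h := hv b
    have e : (v b)⁻¹ - (2 / M - v b / M ^ 2) = (v b - M) ^ 2 / (v b * M ^ 2) := by
      field_simp
      ring
    have : 0 ≤ (v b - M) ^ 2 / (v b * M ^ 2) := by positivity
    linarith
  have h2 := integral_mono ((integrable_const _).sub (hvi.div_const _)) hui h1
  simp only [Pi.sub_apply] at h2
  rw [integral_sub (integrable_const _) (hvi.div_const _), integral_const,
    probReal_univ, one_smul, integral_div] at h2
  refine le_trans ?_ h2
  have h3 : (∫ b, v b ∂Ξ) / M ^ 2 ≤ M / M ^ 2 := by gcongr
  have e : M⁻¹ = 2 / M - M / M ^ 2 := by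
    field_simp
    ring
  linarith

/-- Here `a` and `b` are the Lipschitz constants at the two samples. Writing `a ≤ |a - b| + max b α`
and dividing by `max b α ≥ α` leaves only the difference of the copies, whatever their size. The
factor `3` comes from squaring a sum of three terms. -/
lemma stepError_pointwise {a b α w s γ κ : ℝ} (ha : 0 ≤ a) (hα : 0 < α) (hw : 0 ≤ w) (hs : 0 < s)
    (hκ : max b α * s ≤ γ - κ) (hγ : max b α * s ≤ γ) :
    (a + w) ^ 2 / (γ * (γ - κ)) ≤ 3 * (|a - b| ^ 2 / α ^ 2 + 1 + w ^ 2 / α ^ 2) / s ^ 2 := by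
  set c := max b α with hc
  have hc0 : 0 < c := hα.trans_le (le_max_right _ _)
  have hαc : α ≤ c := le_max_right _ _
  have hbc : b ≤ c := le_max_left _ _
  have h1 : (c * s) ^ 2 ≤ γ * (γ - κ) := by
    rw [sq]
    exact mul_le_mul hγ hκ (by positivity) ((by positivity : 0 ≤ c * s).trans hγ)
  have h2 : (a + w) / c ≤ |a - b| / α + 1 + w / α := by
    have h3 : |a - b| / c ≤ |a - b| / α := by gcongr
    have h4 : w / c ≤ w / α := by gcongr
    have h5 : (a + w) / c ≤ (|a - b| + c + w) / c := by
      gcongr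
      linarith [le_abs_self (a - b)]
    rw [add_div (|a - b| + c), add_div |a - b|, div_self hc0.ne'] at h5
    linarith
  have h6 : ((a + w) / c) ^ 2 ≤ (|a - b| / α + 1 + w / α) ^ 2 :=
    pow_le_pow_left₀ (by positivity) h2 2
  calc (a + w) ^ 2 / (γ * (γ - κ)) ≤ (a + w) ^ 2 / (c * s) ^ 2 := by gcongr
    _ = ((a + w) / c) ^ 2 / s ^ 2 := by rw [div_pow, mul_pow, div_div]
    _ ≤ _ := by
      gcongr
      refine h6.trans ?_
      rw [← div_pow, ← div_pow]
      nlinarith [sq_nonneg (|a - b| / α - 1), sq_nonneg (|a - b| / α - w / α),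
        sq_nonneg (w / α - 1)]

/-- The expected bound for one step of the method, at a fixed anchor: `L` is the random Lipschitz
constant, `δ` the random increment of the model towards the proximal point and `s` the growth of
the regularization weight. -/
lemma lintegral_stepBound_le {κ τ ρ Λ α σ s r e g w : ℝ} (hκ : 0 ≤ κ) (hτ : 0 ≤ τ)
    (hρ : κ + τ < ρ) (hα : 0 < α) (hs : 0 < s) (hg : 0 ≤ g) (hw : 0 ≤ w)
    (he : -Λ ≤ e) {L δ : S → ℝ} (hL : Measurable L) (hL0 : ∀ a, 0 ≤ L a)
    (hLi : Integrable (fun p : S × S => |L p.1 - L p.2| ^ 2) (Ξ.prod Ξ))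
    (hLσ : ∫ p : S × S, |L p.1 - L p.2| ^ 2 ∂(Ξ.prod Ξ) ≤ σ ^ 2)
    (hLg : ∫ a, L a ∂Ξ ≤ g) (hδ : Integrable δ Ξ)
    (hδL : ∀ᵐ a ∂Ξ, -((L a + w) * r) ≤ δ a)
    (hδr : ∫ a, δ a ∂Ξ ≤ -((2 * ρ - κ - 2 * τ) / 2 * r ^ 2))
    {γ : S → ℝ} (hγ : ∀ b, γ b = ρ + κ + τ + max (L b) α * s) :
    (∫⁻ z : S × S, ENNReal.ofReal (e + ρ / (γ z.2 - κ) * stepBound (γ z.2) r (δ z.1) (L z.1 + w) + Λ)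
        ∂(Ξ.prod Ξ)) + ENNReal.ofReal (ρ * (ρ - κ - τ) * r ^ 2 / (ρ + τ + (g + α) * s))
      ≤ ENNReal.ofReal (e + ρ / 2 * r ^ 2 + Λ)
        + ENNReal.ofReal (ρ / 2 * (3 * (σ ^ 2 / α ^ 2 + 1 + w ^ 2 / α ^ 2) / s ^ 2)) := by
  have hρ0 : 0 < ρ := by linarith
  have hmax : ∀ b, 0 < max (L b) α := fun b => hα.trans_le (le_max_right _ _)
  have hms : ∀ b, 0 < max (L b) α * s := fun b => mul_pos (hmax b) hs
  have hγκ : ∀ b, 0 < γ b - κ := fun b => by rw [hγ]; linarith [hms b]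
  have hγ0 : ∀ b, 0 < γ b := fun b => by linarith [hγκ b]
  have hγm : Measurable γ := by
    have : γ = fun b => ρ + κ + τ + max (L b) α * s := funext hγ
    rw [this]
    fun_prop
  have hL2 := memLp_two_of_integrable_sub_sq hL hLi
  have hL1 : Integrable L Ξ := hL2.integrable one_le_two
  -- the reciprocal weight
  have hui : Integrable (fun b => (γ b - κ)⁻¹) Ξ := by
    refine Integrable.of_bound (hγm.sub_const κ).inv.aestronglyMeasurable (ρ)⁻¹
      (Eventually.of_forall fun b => ?_)
    rw [Real.norm_of_nonneg (inv_nonneg.2 (hγκ b).le)]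
    gcongr
    rw [hγ]
    linarith [hms b]
  have hLα : Integrable (fun b => (L b + α) * s) Ξ :=
    (hL1.add (integrable_const _)).mul_const s
  have hmaxi : Integrable (fun b => max (L b) α) Ξ := hL1.sup (integrable_const α)
  have hvi : Integrable (fun b => γ b - κ) Ξ := by
    have : (fun b => γ b - κ) = fun b => ρ + τ + max (L b) α * s := by
      funext b
      rw [hγ]
      ring
    rw [this]
    exact (integrable_const _).add (hmaxi.mul_const s)
  have hvM : ∫ b, (γ b - κ) ∂Ξ ≤ ρ + τ + (g + α) * s := by
    have h1 : ∫ b, (γ b - κ) ∂Ξ ≤ ∫ b, (ρ + τ + (L b + α) * s) ∂Ξ := by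
      refine integral_mono hvi ((integrable_const _).add hLα) fun b => ?_
      have : max (L b) α ≤ L b + α := max_le (by linarith) (by linarith [hL0 b])
      have := mul_le_mul_of_nonneg_right this hs.le
      simp only [hγ]
      linarith
    refine h1.trans ?_
    rw [integral_add (integrable_const _) hLα,
      integral_mul_const, integral_add hL1 (integrable_const _)]
    simp only [integral_const, probReal_univ, one_smul]
    gcongr
  have hM : 0 < ρ + τ + (g + α) * s := by positivity
  have hU := inv_le_integral_inv hγκ hvi hui hM hvM
  set U := ∫ b, (γ b - κ)⁻¹ ∂Ξ with hUdef
  -- the error term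
  have herr : ∀ z : S × S, (L z.1 + w) ^ 2 / (γ z.2 * (γ z.2 - κ)) ≤
      3 * (|L z.1 - L z.2| ^ 2 / α ^ 2 + 1 + w ^ 2 / α ^ 2) / s ^ 2 := fun z =>
    stepError_pointwise (hL0 _) hα hw hs (by rw [hγ]; linarith) (by rw [hγ]; linarith)
  have hσi : Integrable (fun z : S × S => |L z.1 - L z.2| ^ 2 / α ^ 2 + 1) (Ξ.prod Ξ) :=
    (hLi.div_const _).add (integrable_const _)
  have hdomi : Integrable (fun z : S × S =>
      3 * (|L z.1 - L z.2| ^ 2 / α ^ 2 + 1 + w ^ 2 / α ^ 2) / s ^ 2) (Ξ.prod Ξ) :=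
    ((hσi.add (integrable_const _)).const_mul 3).div_const _
  have herri : Integrable (fun z : S × S => (L z.1 + w) ^ 2 / (γ z.2 * (γ z.2 - κ)))
      (Ξ.prod Ξ) := by
    refine hdomi.mono' (by
      have h1 : Measurable fun z : S × S => (L z.1 + w) ^ 2 := by fun_prop
      have h2 : Measurable fun z : S × S => γ z.2 * (γ z.2 - κ) := by fun_prop
      exact (h1.div h2).aestronglyMeasurable) (Eventually.of_forall fun z => ?_)
    rw [Real.norm_of_nonneg]
    · exact herr z
    · have := hγκ z.2
      have := hγ0 z.2
      positivity
  have herrI : ∫ z : S × S, (L z.1 + w) ^ 2 / (γ z.2 * (γ z.2 - κ)) ∂(Ξ.prod Ξ) ≤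
      3 * (σ ^ 2 / α ^ 2 + 1 + w ^ 2 / α ^ 2) / s ^ 2 := by
    refine (integral_mono herri hdomi herr).trans ?_
    rw [integral_div, integral_const_mul, integral_add hσi (integrable_const _),
      integral_add (hLi.div_const _) (integrable_const _), integral_div]
    simp only [integral_const, probReal_univ, one_smul]
    gcongr
  -- decomposition of the bound
  have hdec : ∀ z : S × S,
      e + ρ / (γ z.2 - κ) * stepBound (γ z.2) r (δ z.1) (L z.1 + w) + Λ =
      (e + ρ / 2 * r ^ 2 + Λ) + ρ * κ / 2 * r ^ 2 * (γ z.2 - κ)⁻¹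
        + ρ * (δ z.1 * (γ z.2 - κ)⁻¹) + ρ / 2 * ((L z.1 + w) ^ 2 / (γ z.2 * (γ z.2 - κ))) := by
    intro z
    have h1 := (hγκ z.2).ne'
    have h2 := (hγ0 z.2).ne'
    unfold stepBound
    field_simp
    ring
  have hi2 : Integrable (fun z : S × S => ρ * κ / 2 * r ^ 2 * (γ z.2 - κ)⁻¹) (Ξ.prod Ξ) :=
    (hui.comp_snd Ξ).const_mul _
  have hi3 : Integrable (fun z : S × S => ρ * (δ z.1 * (γ z.2 - κ)⁻¹)) (Ξ.prod Ξ) :=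
    (hδ.mul_prod hui).const_mul ρ
  have hi4 : Integrable (fun z : S × S => ρ / 2 * ((L z.1 + w) ^ 2 / (γ z.2 * (γ z.2 - κ))))
      (Ξ.prod Ξ) := herri.const_mul _
  have hi12 : Integrable (fun z : S × S =>
      (e + ρ / 2 * r ^ 2 + Λ) + ρ * κ / 2 * r ^ 2 * (γ z.2 - κ)⁻¹) (Ξ.prod Ξ) :=
    (integrable_const _).add hi2
  have hi123 : Integrable (fun z : S × S =>
      (e + ρ / 2 * r ^ 2 + Λ) + ρ * κ / 2 * r ^ 2 * (γ z.2 - κ)⁻¹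
        + ρ * (δ z.1 * (γ z.2 - κ)⁻¹)) (Ξ.prod Ξ) := hi12.add hi3
  have hi : Integrable (fun z : S × S =>
      e + ρ / (γ z.2 - κ) * stepBound (γ z.2) r (δ z.1) (L z.1 + w) + Λ) (Ξ.prod Ξ) := by
    simp only [hdec]
    exact hi123.add hi4
  -- The increment `δ` depends on the first sample only and the weight on the second only, so the
  -- mixed term factors. The remainder of `γ / (γ - κ) = 1 + κ / (γ - κ)` and the bound on the mean
  -- of `δ` add up to `-ρ (ρ - κ - τ) r² U`.
  have hI : ∫ z : S × S, (e + ρ / (γ z.2 - κ) * stepBound (γ z.2) r (δ z.1) (L z.1 + w) + Λ)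
      ∂(Ξ.prod Ξ) ≤ (e + ρ / 2 * r ^ 2 + Λ) - ρ * (ρ - κ - τ) * r ^ 2 / (ρ + τ + (g + α) * s)
        + ρ / 2 * (3 * (σ ^ 2 / α ^ 2 + 1 + w ^ 2 / α ^ 2) / s ^ 2) := by
    simp only [hdec]
    rw [integral_add hi123 hi4, integral_add hi12 hi3, integral_add (integrable_const _) hi2,
      integral_const_mul, integral_const_mul, integral_const_mul, integral_prod_mul δ (fun b => (γ b - κ)⁻¹),
      integral_const, probReal_univ, one_smul,
      integral_fun_snd (μ := Ξ) (ν := Ξ) (fun b => (γ b - κ)⁻¹), probReal_univ, one_smul, ← hUdef]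
    have hU0 : 0 ≤ U := (inv_nonneg.2 hM.le).trans hU
    have h1 : (∫ a, δ a ∂Ξ) * U ≤ -((2 * ρ - κ - 2 * τ) / 2 * r ^ 2) * U :=
      mul_le_mul_of_nonneg_right hδr hU0
    have h2 : ρ * ((∫ a, δ a ∂Ξ) * U) ≤ ρ * (-((2 * ρ - κ - 2 * τ) / 2 * r ^ 2) * U) :=
      mul_le_mul_of_nonneg_left h1 hρ0.le
    have h3 : ρ / 2 * ∫ z : S × S, (L z.1 + w) ^ 2 / (γ z.2 * (γ z.2 - κ)) ∂(Ξ.prod Ξ) ≤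
        ρ / 2 * (3 * (σ ^ 2 / α ^ 2 + 1 + w ^ 2 / α ^ 2) / s ^ 2) :=
      mul_le_mul_of_nonneg_left herrI (by positivity)
    have h4 : ρ * (ρ - κ - τ) * r ^ 2 / (ρ + τ + (g + α) * s) ≤ ρ * (ρ - κ - τ) * r ^ 2 * U := by
      rw [div_eq_mul_inv]
      have : 0 ≤ ρ - κ - τ := by linarith
      exact mul_le_mul_of_nonneg_left hU (by positivity)
    have e1 : ρ * κ / 2 * r ^ 2 * U + ρ * (-((2 * ρ - κ - 2 * τ) / 2 * r ^ 2) * U)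
        = -(ρ * (ρ - κ - τ) * r ^ 2 * U) := by ring
    linarith
  have hpos : 0 ≤ᵐ[Ξ.prod Ξ] fun z : S × S =>
      e + ρ / (γ z.2 - κ) * stepBound (γ z.2) r (δ z.1) (L z.1 + w) + Λ := by
    filter_upwards [Measure.quasiMeasurePreserving_fst.ae hδL] with z hz
    have h1 := stepBound_nonneg (hγ0 z.2) hz
    have h2 := hγκ z.2
    have h3 : 0 ≤ ρ / (γ z.2 - κ) * stepBound (γ z.2) r (δ z.1) (L z.1 + w) := by positivity
    simp only [Pi.zero_apply]
    linarith
  rw [← ofReal_integral_eq_lintegral_ofReal hi hpos]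
  have hρκ : 0 ≤ ρ - κ - τ := by linarith
  have hr2 : 0 ≤ ρ / 2 * r ^ 2 := by positivity
  rw [← ENNReal.ofReal_add (integral_nonneg_of_ae hpos) (by positivity),
    ← ENNReal.ofReal_add (by linarith) (by positivity)]
  exact ENNReal.ofReal_le_ofReal (by linarith)

end Expectation

end StochasticModel

namespace StochasticModel

/-! ### Almost-supermartingale convergence -/

section RobbinsSiegmund

variable {Ω : Type*} {m0 : MeasurableSpace Ω} {P : Measure Ω} [IsProbabilityMeasure P]

/-- The Robbins-Siegmund almost-supermartingale convergence theorem, with deterministic errors and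
the conditional expectations expressed through integrals over sets of the filtration. -/
theorem ae_bddAbove_and_summable_of_almost_supermartingale {ℱ : Filtration ℕ m0}
    {V A : ℕ → Ω → ℝ} {c : ℕ → ℝ} (hV0 : ∀ k w, 0 ≤ V k w) (hA0 : ∀ k w, 0 ≤ A k w)
    (hc0 : ∀ k, 0 ≤ c k) (hc : Summable c) (hV : StronglyAdapted ℱ V) (hA : StronglyAdapted ℱ A)
    (hinit : Integrable (V 0) P)
    (hstep : ∀ k, ∀ s, MeasurableSet[ℱ k] s →
      (∫⁻ w in s, ENNReal.ofReal (V (k + 1) w) ∂P) + (∫⁻ w in s, ENNReal.ofReal (A k w) ∂P) ≤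
        (∫⁻ w in s, ENNReal.ofReal (V k w) ∂P) + ENNReal.ofReal (c k) * P s) :
    ∀ᵐ w ∂P, BddAbove (Set.range fun k => V k w) ∧ Summable fun k => A k w := by
  have hVm : ∀ k, AEStronglyMeasurable (V k) P := fun k =>
    ((hV k).mono (ℱ.le k)).aestronglyMeasurable
  have hAm : ∀ k, AEStronglyMeasurable (A k) P := fun k =>
    ((hA k).mono (ℱ.le k)).aestronglyMeasurable
  have hfin : ∀ {f : Ω → ℝ}, AEStronglyMeasurable f P → (∀ w, 0 ≤ f w) →
      ((∫⁻ w, ENNReal.ofReal (f w) ∂P) < ⊤ ↔ Integrable f P) := fun {f} hf h0 => by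
    rw [← hasFiniteIntegral_iff_ofReal (Eventually.of_forall h0)]
    exact ⟨fun h => ⟨hf, h⟩, fun h => h.2⟩
  -- Integrability is not assumed beyond time zero: the step inequality over the whole space
  -- propagates finiteness of the nonnegative integrals.
  have hstep1 : ∀ k, Integrable (V k) P → Integrable (V (k + 1)) P ∧ Integrable (A k) P := by
    intro k hk
    have h1 := hstep k Set.univ MeasurableSet.univ
    simp only [Measure.restrict_univ, measure_univ, mul_one] at h1
    have h2 := h1.trans_lt (ENNReal.add_lt_top.2
      ⟨(hfin (hVm k) (hV0 k)).2 hk, ENNReal.ofReal_lt_top⟩)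
    exact ⟨(hfin (hVm _) (hV0 _)).1 (le_self_add.trans_lt h2),
      (hfin (hAm _) (hA0 _)).1 (le_add_self.trans_lt h2)⟩
  have hVi : ∀ k, Integrable (V k) P := fun k => by
    induction k with
    | zero => exact hinit
    | succ k ih => exact (hstep1 k ih).1
  have hAi : ∀ k, Integrable (A k) P := fun k => (hstep1 k (hVi k)).2
  have hstepR : ∀ k, ∀ s, MeasurableSet[ℱ k] s →
      (∫ w in s, V (k + 1) w ∂P) + (∫ w in s, A k w ∂P) ≤
        (∫ w in s, V k w ∂P) + ∫ _ in s, c k ∂P := by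
    intro k s hs
    have h1 := hstep k s hs
    rw [← ofReal_integral_eq_lintegral_ofReal (hVi _).integrableOn
        (Eventually.of_forall (hV0 _)), ← ofReal_integral_eq_lintegral_ofReal
        (hAi _).integrableOn (Eventually.of_forall (hA0 _)),
      ← ofReal_integral_eq_lintegral_ofReal (hVi _).integrableOn
        (Eventually.of_forall (hV0 _)), ← ENNReal.ofReal_add (integral_nonneg (hV0 _))
        (integral_nonneg (hA0 _)), ← ofReal_measureReal, ← ENNReal.ofReal_mul (hc0 k),
      ← ENNReal.ofReal_add (integral_nonneg (hV0 _)) (mul_nonneg (hc0 k) measureReal_nonneg),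
      ENNReal.ofReal_le_ofReal_iff (add_nonneg (integral_nonneg (hV0 _))
        (mul_nonneg (hc0 k) measureReal_nonneg))] at h1
    rw [setIntegral_const, smul_eq_mul, mul_comm]
    exact h1
  set C := ∑' k, c k with hC
  have hCk : ∀ k, ∑ j ∈ Finset.range k, c j ≤ C := fun k => hc.sum_le_tsum _ fun j _ => hc0 j
  -- the compensated process is a nonnegative supermartingale
  set W : ℕ → Ω → ℝ := fun k w =>
    V k w + (∑ j ∈ Finset.range k, A j w) + (C - ∑ j ∈ Finset.range k, c j) with hW
  have hW0 : ∀ k w, 0 ≤ W k w := fun k w =>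
    add_nonneg (add_nonneg (hV0 k w) (Finset.sum_nonneg fun j _ => hA0 j w))
      (sub_nonneg.2 (hCk k))
  have hSi : ∀ k, Integrable (fun w => ∑ j ∈ Finset.range k, A j w) P := fun k =>
    integrable_finsetSum _ fun j _ => hAi j
  have hWi : ∀ k, Integrable (W k) P := fun k =>
    ((hVi k).add (hSi k)).add (integrable_const _)
  have hWad : StronglyAdapted ℱ W := fun k => by
    refine ((hV k).add ?_).add stronglyMeasurable_const
    exact Finset.stronglyMeasurable_fun_sum _ fun j hj =>
      (hA j).mono (ℱ.mono (Finset.mem_range.1 hj).le)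
  have hsuper : Supermartingale W ℱ P := by
    refine supermartingale_of_setIntegral_succ_le hWad hWi fun k s hs => ?_
    have h1 := hstepR k s hs
    have h2 : ∀ w, W (k + 1) w = (V (k + 1) w + A k w) +
        ((∑ j ∈ Finset.range k, A j w) + (C - ∑ j ∈ Finset.range k, c j)) - c k := fun w => by
      simp only [hW, Finset.sum_range_succ]
      ring
    have h3 : ∀ w, W k w = V k w +
        ((∑ j ∈ Finset.range k, A j w) + (C - ∑ j ∈ Finset.range k, c j)) := fun w => by
      simp only [hW]
      ring
    have hRi : Integrable (fun w =>
        (∑ j ∈ Finset.range k, A j w) + (C - ∑ j ∈ Finset.range k, c j)) P :=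
      (hSi k).add (integrable_const _)
    have hVAi : Integrable (fun w => V (k + 1) w + A k w) P := (hVi _).add (hAi k)
    have hVARi : Integrable (fun w => V (k + 1) w + A k w +
        ((∑ j ∈ Finset.range k, A j w) + (C - ∑ j ∈ Finset.range k, c j))) P := hVAi.add hRi
    simp only [h2, h3]
    rw [integral_sub hVARi.integrableOn (integrable_const _),
      integral_add hVAi.integrableOn hRi.integrableOn,
      integral_add (hVi _).integrableOn (hAi _).integrableOn,
      integral_add (hVi _).integrableOn hRi.integrableOn]
    linarith
  -- As `W` is nonnegative, its `L¹` norm is its mean, which does not increase.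
  have hbdd : ∀ k, eLpNorm ((-W) k) 1 P ≤ (Real.toNNReal (∫ w, W 0 w ∂P) : ℝ≥0) := fun k => by
    have h1 : ∫ w, W k w ∂P ≤ ∫ w, W 0 w ∂P := by
      simpa using hsuper.setIntegral_le (Nat.zero_le k) MeasurableSet.univ
    rw [Pi.neg_apply, eLpNorm_neg, eLpNorm_one_eq_lintegral_enorm]
    have h2 : ∀ w, ‖W k w‖ₑ = ENNReal.ofReal (W k w) := fun w => Real.enorm_of_nonneg (hW0 k w)
    simp only [h2]
    rw [← ofReal_integral_eq_lintegral_ofReal (hWi k) (Eventually.of_forall (hW0 k))]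
    exact ENNReal.ofReal_le_ofReal h1
  filter_upwards [hsuper.neg.exists_ae_tendsto_of_bdd hbdd] with w ⟨l, hl⟩
  obtain ⟨b, hb⟩ := hl.bddBelow_range
  have hb' : ∀ k, V k w + ∑ j ∈ Finset.range k, A j w ≤ -b := fun k => by
    have h1 : b ≤ -W k w := hb ⟨k, rfl⟩
    have h2 := hCk k
    simp only [hW] at h1
    linarith
  refine ⟨⟨-b, ?_⟩, summable_of_sum_range_le (c := -b) (fun k => hA0 k w) fun k => ?_⟩
  · rintro _ ⟨k, rfl⟩
    have := Finset.sum_nonneg fun j (_ : j ∈ Finset.range k) => hA0 j w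
    have := hb' k
    simp only
    linarith
  · have := hb' k
    linarith [hV0 k w]

end RobbinsSiegmund

end StochasticModel

namespace StochasticModel

/-! ### The filtration of samples and its independence from the next pair -/

section Sampling

variable {Ω S : Type*} [MeasurableSpace S]

lemma measurable_pastSigma {ξ ξ' : ℕ → Ω → S} {j k : ℕ} (hjk : j < k) :
    Measurable[pastSigma ξ ξ' k] (ξ j) ∧ Measurable[pastSigma ξ ξ' k] (ξ' j) := by
  have h : MeasurableSpace.comap (ξ j) inferInstance ⊔ MeasurableSpace.comap (ξ' j) inferInstance
      ≤ pastSigma ξ ξ' k :=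
    le_iSup (fun j : Set.Iio k => MeasurableSpace.comap (ξ j) inferInstance ⊔
      MeasurableSpace.comap (ξ' j) inferInstance) ⟨j, hjk⟩
  exact ⟨measurable_iff_comap_le.2 (le_sup_left.trans h),
    measurable_iff_comap_le.2 (le_sup_right.trans h)⟩

lemma pastSigma_le {ξ ξ' : ℕ → Ω → S} {k : ℕ} {m : MeasurableSpace Ω}
    (h : ∀ j < k, Measurable[m] (ξ j) ∧ Measurable[m] (ξ' j)) : pastSigma ξ ξ' k ≤ m :=
  iSup_le fun j => sup_le (h j j.2).1.comap_le (h j j.2).2.comap_le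

variable {m0 : MeasurableSpace Ω} {P : Measure Ω} {Ξ : Measure S} {ξ ξ' : ℕ → Ω → S}

/-- The filtration of the samples drawn before each iteration. -/
def IsSampling.filtration (hξ : IsSampling P Ξ ξ ξ') : Filtration ℕ m0 where
  seq := pastSigma ξ ξ'
  mono' _ _ hij := pastSigma_le fun _ hl => measurable_pastSigma (hl.trans_le hij)
  le' _ := pastSigma_le fun j _ => ⟨hξ.measurable j, hξ.measurable' j⟩

/-- The map `Sum.elim id id` reads the time index of a sample from either sequence. The blocks of
times `< k` and `= k` are disjoint in the joint independent family, so they generate independent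
σ-algebras. -/
lemma IsSampling.indep_pastSigma (hξ : IsSampling P Ξ ξ ξ') (k : ℕ) :
    Indep (pastSigma ξ ξ' k)
      (MeasurableSpace.comap (fun w => (ξ k w, ξ' k w)) inferInstance) P := by
  have h := indep_iSup_of_disjoint (S := {i | Sum.elim id id i < k})
    (T := {i | Sum.elim id id i = k}) (fun i => Measurable.comap_le (by
      rcases i with i | i
      exacts [hξ.measurable i, hξ.measurable' i])) hξ.indep.iIndep (by
      rw [Set.disjoint_left]
      intro i hi hi'
      exact (ne_of_lt hi) hi')
  refine indep_of_indep_of_le_left (indep_of_indep_of_le_right h ?_) (pastSigma_le fun j hj => ?_)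
  · refine (MeasurableSpace.comap_prodMk (ξ k) (ξ' k)).le.trans (sup_le ?_ ?_)
    · exact le_iSup₂_of_le (f := fun i (_ : i ∈ {i | Sum.elim id id i = k}) =>
        MeasurableSpace.comap (Sum.elim ξ ξ' i) inferInstance) (Sum.inl k) rfl le_rfl
    · exact le_iSup₂_of_le (f := fun i (_ : i ∈ {i | Sum.elim id id i = k}) =>
        MeasurableSpace.comap (Sum.elim ξ ξ' i) inferInstance) (Sum.inr k) rfl le_rfl
  · exact ⟨measurable_iff_comap_le.2
      (le_iSup₂_of_le (f := fun i (_ : i ∈ {i | Sum.elim id id i < k}) =>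
        MeasurableSpace.comap (Sum.elim ξ ξ' i) inferInstance) (Sum.inl j) hj le_rfl),
      measurable_iff_comap_le.2
      (le_iSup₂_of_le (f := fun i (_ : i ∈ {i | Sum.elim id id i < k}) =>
        MeasurableSpace.comap (Sum.elim ξ ξ' i) inferInstance) (Sum.inr j) hj le_rfl)⟩

lemma IsSampling.map_prodMk [IsProbabilityMeasure P] (hξ : IsSampling P Ξ ξ ξ') (k : ℕ) :
    P.map (fun w => (ξ k w, ξ' k w)) = Ξ.prod Ξ := by
  have h : IndepFun (ξ k) (ξ' k) P := hξ.indep.indepFun (i := Sum.inl k) (j := Sum.inr k) (by simp)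
  rw [h.map_prod_eq_prod_map_map (hξ.measurable k).aemeasurable (hξ.measurable' k).aemeasurable,
    hξ.law, hξ.law']

end Sampling

/-! ### Integrating out fresh samples -/

section Freezing

/-- Freezing lemma: a variable that is independent of a σ-algebra can be integrated out first. -/
lemma setLIntegral_comp_of_indep {Ω A B : Type*} [MeasurableSpace A] [MeasurableSpace B]
    {𝓕 m0 : MeasurableSpace Ω} {P : Measure Ω} [IsProbabilityMeasure P] (h𝓕 : 𝓕 ≤ m0) {U : Ω → A} (hU : Measurable[𝓕] U)
    {V : Ω → B} (hV : Measurable V)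
    (hind : Indep 𝓕 (MeasurableSpace.comap V inferInstance) P) {s : Set Ω}
    (hs : MeasurableSet[𝓕] s) {g : A × B → ENNReal} (hg : Measurable g) :
    ∫⁻ w in s, g (U w, V w) ∂P = ∫⁻ w in s, ∫⁻ b, g (U w, b) ∂(P.map V) ∂P := by
  -- The indicator of `s` is carried as an additional `𝓕`-measurable coordinate, which turns the
  -- integral over `s` into an integral against a product law.
  set J : Ω → A × ENNReal := fun w => (U w, s.indicator 1 w) with hJ
  have hJm : Measurable[𝓕] J :=
    (fun {𝓖 : MeasurableSpace Ω} (hU : Measurable[𝓖] U) (hs : MeasurableSet[𝓖] s) =>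
      show Measurable J from hU.prodMk (measurable_one.indicator hs)) hU hs
  have hJm0 : Measurable J := hJm.mono h𝓕 le_rfl
  have hJV : IndepFun J V P := indep_of_indep_of_le_left hind hJm.comap_le
  have hmap := hJV.map_prod_eq_prod_map_map hJm0.aemeasurable hV.aemeasurable
  have : IsProbabilityMeasure (P.map V) := Measure.isProbabilityMeasure_map hV.aemeasurable
  have hgm : Measurable fun z : (A × ENNReal) × B => z.1.2 * g (z.1.1, z.2) := by fun_prop
  have hs0 : MeasurableSet s := h𝓕 s hs
  have hind1 : ∀ (f : Ω → ENNReal), ∫⁻ w in s, f w ∂P = ∫⁻ w, s.indicator 1 w * f w ∂P := by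
    intro f
    rw [← lintegral_indicator hs0]
    refine lintegral_congr fun w => ?_
    by_cases hw : w ∈ s <;> simp [hw]
  calc ∫⁻ w in s, g (U w, V w) ∂P
      = ∫⁻ w, (fun z : (A × ENNReal) × B => z.1.2 * g (z.1.1, z.2)) (J w, V w) ∂P := hind1 _
    _ = ∫⁻ z, z.1.2 * g (z.1.1, z.2) ∂((P.map J).prod (P.map V)) := by
        rw [← hmap, lintegral_map hgm (hJm0.prodMk hV)]
    _ = ∫⁻ a, ∫⁻ b, a.2 * g (a.1, b) ∂(P.map V) ∂(P.map J) :=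
        lintegral_prod _ hgm.aemeasurable
    _ = ∫⁻ w, ∫⁻ b, (J w).2 * g ((J w).1, b) ∂(P.map V) ∂P :=
        lintegral_map hgm.lintegral_prod_right' hJm0
    _ = ∫⁻ w, s.indicator 1 w * ∫⁻ b, g (U w, b) ∂(P.map V) ∂P := by
        exact lintegral_congr fun w =>
          lintegral_const_mul _ (hg.comp (measurable_prodMk_left (x := U w)))
    _ = _ := (hind1 _).symm

end Freezing

/-! ### Regularity of the objective from its stochastic models -/

section Model

lemma IsReferenceLipschitz.integrable_lip {E S : Type*} [NormedAddCommGroup E] [MeasurableSpace S]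
    {Ξ : Measure S} [IsProbabilityMeasure Ξ] {D : Set E} {m : E → E → S → ℝ} {Lip : E → S → ℝ≥0} {σ : ℝ}
    (hLip : IsReferenceLipschitz Ξ D m Lip σ) {x : E} (hx : x ∈ D) (hmeas : Measurable (Lip x)) :
    Integrable (fun ξ => (Lip x ξ : ℝ)) Ξ :=
  (memLp_two_of_integrable_sub_sq hmeas.coe_nnreal_real (hLip.integrable x hx)).integrable
    one_le_two

variable {E : Type*} [NormedAddCommGroup E] [InnerProductSpace ℝ E]
variable {S : Type*} [MeasurableSpace S] {Ξ : Measure S}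
variable {F : E → S → ℝ} {D : Set E} {τ : ℝ} {m : E → E → S → ℝ}

lemma IsStochasticModel.convexOn_integral (hm : IsStochasticModel Ξ F D τ m) (hD : Convex ℝ D)
    {x : E} (hx : x ∈ D) : ConvexOn ℝ D fun y => ∫ ξ, m x y ξ ∂Ξ := by
  refine ⟨hD, fun y hy z hz a b ha hb hab => ?_⟩
  have hy' := (hm.integrable_model x hx y hy).const_mul a
  have hz' := (hm.integrable_model x hx z hz).const_mul b
  simp only [smul_eq_mul]
  rw [← integral_const_mul, ← integral_const_mul, ← integral_add hy' hz']
  refine integral_mono_ae (hm.integrable_model x hx _ (hD hy hz ha hb hab)) (hy'.add hz') ?_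
  filter_upwards [hm.convex] with ξ hξ
  exact (hξ x hx).2 hy hz ha hb hab

lemma IsStochasticModel.strongConvexOn (hm : IsStochasticModel Ξ F D τ m) (hD : Convex ℝ D) :
    StrongConvexOn D (-τ) fun y => ∫ ξ, F y ξ ∂Ξ :=
  strongConvexOn_of_models hD (q := fun x y => ∫ ξ, m x y ξ ∂Ξ)
    (fun _ hx => hm.convexOn_integral hD hx) hm.unbiased hm.lower

/-- The expected model is Lipschitz, hence so is the objective at each anchor, up to a quadratic
term. -/
lemma IsStochasticModel.obj_sub_le (hm : IsStochasticModel Ξ F D τ m) {Lip : E → S → ℝ≥0} {σ : ℝ}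
    (hLip : IsReferenceLipschitz Ξ D m Lip σ) {x y : E} (hx : x ∈ D) (hy : y ∈ D)
    (hint : Integrable (fun ξ => (Lip x ξ : ℝ)) Ξ) :
    ∫ ξ, F x ξ ∂Ξ - ∫ ξ, F y ξ ∂Ξ ≤
      (∫ ξ, (Lip x ξ : ℝ) ∂Ξ) * ‖x - y‖ + τ / 2 * ‖x - y‖ ^ 2 := by
  have h1 : ∫ ξ, m x x ξ ∂Ξ - ∫ ξ, m x y ξ ∂Ξ ≤ (∫ ξ, (Lip x ξ : ℝ) ∂Ξ) * ‖x - y‖ := by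
    rw [← integral_sub (hm.integrable_model x hx x hx) (hm.integrable_model x hx y hy),
      ← integral_mul_const]
    refine integral_mono_ae ((hm.integrable_model x hx x hx).sub (hm.integrable_model x hx y hy))
      (hint.mul_const _) ?_
    filter_upwards [hLip.lipschitz] with ξ hξ
    have := (le_abs_self _).trans ((hξ x hx).dist_le_mul x y)
    rwa [dist_eq_norm] at this
  have h2 := hm.lower x hx y hy
  rw [hm.unbiased x hx] at h1
  linarith

/-- The one-sided estimate `obj_sub_le` is applied with each of the two points as anchor. One of the
anchors moves; continuity of the growth function keeps its Lipschitz constant bounded near `x`. -/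
lemma IsStochasticModel.continuousOn_obj (hm : IsStochasticModel Ξ F D τ m) {Lip : E → S → ℝ≥0}
    {σ : ℝ} (hLip : IsReferenceLipschitz Ξ D m Lip σ)
    (hint : ∀ x ∈ D, Integrable (fun ξ => (Lip x ξ : ℝ)) Ξ) {G : ℝ≥0 → ℝ≥0} (hG : Continuous G)
    (hGL : ∀ x ∈ D, ∫ ξ, (Lip x ξ : ℝ) ∂Ξ ≤ G ‖x‖₊) :
    ContinuousOn (fun y => ∫ ξ, F y ξ ∂Ξ) D := by
  intro x hx
  have hlim : Tendsto (fun y => ((G ‖y‖₊ : ℝ) + G ‖x‖₊) * ‖y - x‖ + τ / 2 * ‖y - x‖ ^ 2)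
      (𝓝[D] x) (𝓝 0) := by
    have : Continuous fun y : E =>
        ((G ‖y‖₊ : ℝ) + G ‖x‖₊) * ‖y - x‖ + τ / 2 * ‖y - x‖ ^ 2 := by fun_prop
    have h := (this.tendsto x).mono_left (nhdsWithin_le_nhds (s := D))
    simpa using h
  refine tendsto_iff_dist_tendsto_zero.2 (squeeze_zero' (Eventually.of_forall fun _ => dist_nonneg)
    ?_ hlim)
  filter_upwards [self_mem_nhdsWithin] with y hy
  have h1 := hm.obj_sub_le hLip hy hx (hint y hy)
  have h2 := hm.obj_sub_le hLip hx hy (hint x hx)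
  rw [norm_sub_rev x y] at h2
  have h3 := mul_le_mul_of_nonneg_right (hGL y hy) (norm_nonneg (y - x))
  have h4 := mul_le_mul_of_nonneg_right (hGL x hx) (norm_nonneg (y - x))
  have h5 : 0 ≤ (G ‖y‖₊ : ℝ) * ‖y - x‖ := by positivity
  have h6 : 0 ≤ (G ‖x‖₊ : ℝ) * ‖y - x‖ := by positivity
  rw [Real.dist_eq, abs_le, add_mul]
  constructor <;> linarith

end Model

/-! ### From summability to small residuals -/

section Limit

/-- A nonnegative sequence that is arbitrarily small somewhere has running infima tending to
zero. -/
lemma tendsto_iInf_Iic_zero {u : ℕ → ℝ} (h0 : ∀ k, 0 ≤ u k) (h : ∀ ε > 0, ∃ k, u k < ε) :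
    Tendsto (fun k : ℕ => ⨅ j : Set.Iic k, u j) atTop (𝓝 0) := by
  rw [Metric.tendsto_atTop]
  intro ε hε
  obtain ⟨N, hN⟩ := h ε hε
  refine ⟨N, fun k hk => ?_⟩
  have hb : BddBelow (Set.range fun j : Set.Iic k => u j) := ⟨0, by
    rintro _ ⟨j, rfl⟩
    exact h0 j⟩
  rw [Real.dist_eq, sub_zero, abs_of_nonneg (Real.iInf_nonneg fun j : Set.Iic k => h0 j)]
  exact (ciInf_le hb ⟨N, hk⟩).trans_lt hN

/-- If the weighted squares of `r` are summable with weights of order `k ^ (-ζ)` and `ζ ≤ 1`, then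
`r` takes arbitrarily small values. -/
lemma exists_lt_of_summable_div {r M : ℕ → ℝ} {a B ζ : ℝ} (ha : 0 < a) (hζ : ζ ≤ 1)
    (hM0 : ∀ k, 0 < M k) (hM : ∀ k : ℕ, M k ≤ B * ((k : ℝ) + 1) ^ ζ)
    (hsum : Summable fun k => a * r k ^ 2 / M k) {ε : ℝ} (hε : 0 < ε) : ∃ k, r k < ε := by
  -- If `r` stayed above `ε`, the terms would dominate a multiple of `(k + 1) ^ (-ζ)`, whose series
  -- diverges.
  by_contra! hr
  have hB : 0 < B := by
    have := (hM0 0).trans_le (hM 0)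
    simpa using this
  have h1 : ∀ k : ℕ, 0 ≤ a * ε ^ 2 / B * (1 / (((k + 1 : ℕ) : ℝ) ^ ζ)) := fun k => by positivity
  have h2 : ∀ k : ℕ, a * ε ^ 2 / B * (1 / (((k + 1 : ℕ) : ℝ) ^ ζ)) ≤ a * r k ^ 2 / M k := fun k => by
    have := hM0 k
    have := hr k
    rw [div_mul_div_comm, mul_one]
    gcongr
    push_cast
    exact hM k
  have h3 := Summable.of_nonneg_of_le h1 h2 hsum
  rw [summable_mul_left_iff (by positivity)] at h3
  have h4 := (summable_nat_add_iff (f := fun n : ℕ => 1 / (n : ℝ) ^ ζ) 1).1 h3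
  exact absurd (Real.summable_one_div_nat_rpow.1 h4) (not_lt.2 hζ)

end Limit

end StochasticModel

namespace StochasticModel

/-! ### The expected estimate for the stochastic model -/

section ExpectedStep

variable {E : Type*} [NormedAddCommGroup E] [InnerProductSpace ℝ E] {S : Type*} [MeasurableSpace S]
  {Ξ : Measure S} {m : E → E → S → ℝ} {ω : E → EReal}

/-- The expected step bound at a fixed anchor `y` with proximal point `q`. -/
lemma lintegral_modelStep_le [IsProbabilityMeasure Ξ]
    {F : E → S → ℝ} {κ τ ρ Λ α σ t : ℝ} {Lω : ℝ≥0} (hκ : 0 ≤ κ) (hτ : 0 ≤ τ) (hρ : κ + τ < ρ)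
    (hα : 0 < α) (ht0 : 0 < t)
    (hω : StrongConvexOn (effDom ω) (-κ) fun y => (ω y).toReal)
    (hω_lip : LipschitzOnWith Lω (fun x => (ω x).toReal) (effDom ω))
    (hm : IsStochasticModel Ξ F (effDom ω) τ m) {Lip : E → S → ℝ≥0}
    (hLip : IsReferenceLipschitz Ξ (effDom ω) m Lip σ) {y : E} (hy : y ∈ effDom ω)
    (hLip_meas : Measurable (Lip y)) {g : ℝ≥0} (hG : ∫ ξ, (Lip y ξ : ℝ) ∂Ξ ≤ g) {q : E}
    (hpy : q ∈ effDom ω) (hmin : ∀ z ∈ effDom ω,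
      ∫ ξ, F q ξ ∂Ξ + (ω q).toReal + ρ / 2 * ‖q - y‖ ^ 2 ≤
        ∫ ξ, F z ξ ∂Ξ + (ω z).toReal + ρ / 2 * ‖z - y‖ ^ 2)
    (hlow : -Λ ≤ ∫ ξ, F q ξ ∂Ξ + (ω q).toReal) :
    (∫⁻ z : S × S, ENNReal.ofReal (∫ ξ, F q ξ ∂Ξ + (ω q).toReal +
        ρ / (ρ + κ + τ + max (Lip y z.2 : ℝ) α * t - κ) *
        stepBound (ρ + κ + τ + max (Lip y z.2 : ℝ) α * t) ‖q - y‖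
          (m y q z.1 - m y y z.1 + ((ω q).toReal - (ω y).toReal)) (Lip y z.1 + Lω) + Λ)
          ∂(Ξ.prod Ξ))
        + ENNReal.ofReal (ρ * (ρ - κ - τ) * ‖q - y‖ ^ 2 / (ρ + τ + (g + α) * t)) ≤
      ENNReal.ofReal (∫ ξ, F q ξ ∂Ξ + (ω q).toReal + ρ / 2 * ‖q - y‖ ^ 2 + Λ)
        + ENNReal.ofReal (ρ / 2 * (3 * (σ ^ 2 / α ^ 2 + 1 + Lω ^ 2 / α ^ 2) / t ^ 2)) := by
  have hmi := (hm.integrable_model y hy _ hpy).sub (hm.integrable_model y hy _ hy)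
  refine lintegral_stepBound_le (γ := fun b => ρ + κ + τ + max (Lip y b : ℝ) α * t) (L := fun a => (Lip y a : ℝ))
    (δ := fun a => m y q a - m y y a + ((ω q).toReal - (ω y).toReal)) hκ hτ hρ hα ht0
    (NNReal.coe_nonneg _) Lω.coe_nonneg hlow
    hLip_meas.coe_nnreal_real (fun a => (Lip y a).coe_nonneg)
    (hLip.integrable y hy) (hLip.noise y hy) hG (hmi.add (integrable_const _)) ?_ ?_
    fun b => rfl
  · filter_upwards [hLip.lipschitz] with a ha
    have h1 := le_add_mul_norm_of_lipschitzOn ((ha y hy).lipschitzOnWith (s := effDom ω)) hy hpy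
    have h2 := le_add_mul_norm_of_lipschitzOn hω_lip hy hpy
    linarith
  · have h1 : ∫ a, (m y q a - m y y a + ((ω q).toReal - (ω y).toReal)) ∂Ξ =
        ∫ a, m y q a ∂Ξ - ∫ a, m y y a ∂Ξ + ((ω q).toReal - (ω y).toReal) := by
      rw [← integral_sub (hm.integrable_model y hy _ hpy) (hm.integrable_model y hy _ hy)]
      refine (integral_add hmi (integrable_const _)).trans ?_
      simp
    have h2 := hm.lower y hy _ hpy
    have h3 := hm.unbiased y hy
    -- Quadratic growth at the proximal point gives a decrease of `ψ` by `(2ρ - κ - τ) / 2 * r²`;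
    -- the model error takes back `τ / 2 * r²`.
    have h4 := prox_growth (strongConvexOn_add (hm.strongConvexOn hω.1) hω) hpy hmin hy
    simp only [sub_self, norm_zero] at h4
    rw [norm_sub_rev y q] at h2 h4
    rw [h1]
    linarith

end ExpectedStep

/-! ### Expected decrease along the run -/

section Run

variable {E : Type*} [NormedAddCommGroup E]
  [MeasurableSpace E] {S : Type*} [MeasurableSpace S] {Ω : Type*} [MeasurableSpace Ω]
  {P : Measure Ω} {Ξ : Measure S} {m : E → E → S → ℝ} {ω : E → EReal} {ξ ξ' : ℕ → Ω → S}
  {γ : ℕ → Ω → ℝ} {x₁ : E} {x : ℕ → Ω → E}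

/-- The iterates stay in the effective domain. -/
lemma IsModelBasedRun.ae_mem_effDom (hx : IsModelBasedRun P m ω ξ ξ' γ x₁ x)
    (hbot : ∀ x, ω x ≠ ⊥) (hx₁ : x₁ ∈ effDom ω) : ∀ᵐ w ∂P, ∀ k, x k w ∈ effDom ω := by
  filter_upwards [hx.step] with w hw k
  induction k with
  | zero => rw [hx.init]; exact hx₁
  | succ k _ => exact (hw k).mem_effDom hbot hx₁

variable [InnerProductSpace ℝ E] [BorelSpace E]

/-- The expected decrease of the envelope along the run, over the events of the past. -/
lemma setLIntegral_envelope_step_le [IsProbabilityMeasure P] [IsProbabilityMeasure Ξ]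
    {F : E → S → ℝ} {κ τ ρ Λ α σ ζ : ℝ} {Lω : ℝ≥0} (hκ : 0 ≤ κ) (hτ : 0 ≤ τ) (hρ : κ + τ < ρ)
    (hα : 0 < α) (hbot : ∀ x, ω x ≠ ⊥) (hω_meas : Measurable ω)
    (hω : StrongConvexOn (effDom ω) (-κ) fun y => (ω y).toReal)
    (hω_lip : LipschitzOnWith Lω (fun x => (ω x).toReal) (effDom ω))
    (hm_meas : Measurable (fun p : E × E × S => m p.1 p.2.1 p.2.2))
    (hm : IsStochasticModel Ξ F (effDom ω) τ m) {Lip : E → S → ℝ≥0}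
    (hLip_meas : Measurable (fun p : E × S => Lip p.1 p.2))
    (hLip : IsReferenceLipschitz Ξ (effDom ω) m Lip σ) {G : ℝ≥0 → ℝ≥0}
    (hG : ∀ x ∈ effDom ω, ∫ ξ, (Lip x ξ : ℝ) ∂Ξ ≤ (G ‖x‖₊ : ℝ))
    {h : E → ℝ} (hh : h = fun y => ∫ ξ, F y ξ ∂Ξ + (ω y).toReal)
    {p : E → E} (hp : IsProxMap (effDom ω) h ρ p) (hpc : Continuous p)
    (hΦ : Continuous fun x => h (p x) + ρ / 2 * ‖p x - x‖ ^ 2)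
    (hlow : ∀ y ∈ effDom ω, -Λ ≤ h y)
    (hξ : IsSampling P Ξ ξ ξ') (hx₁ : x₁ ∈ effDom ω)
    (hx : IsModelBasedRun P m ω ξ ξ'
      (fun k w => ρ + κ + τ + max (Lip (x k w) (ξ' k w) : ℝ) α * ((k : ℝ) + 1) ^ ζ) x₁ x)
    (k : ℕ) {s : Set Ω} (hs : MeasurableSet[pastSigma ξ ξ' k] s) :
    (∫⁻ w in s, ENNReal.ofReal (h (p (x (k + 1) w))
        + ρ / 2 * ‖p (x (k + 1) w) - x (k + 1) w‖ ^ 2 + Λ) ∂P)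
      + (∫⁻ w in s, ENNReal.ofReal (ρ * (ρ - κ - τ) * ‖p (x k w) - x k w‖ ^ 2 /
        (ρ + τ + (G ‖x k w‖₊ + α) * ((k : ℝ) + 1) ^ ζ)) ∂P)
      ≤ (∫⁻ w in s, ENNReal.ofReal (h (p (x k w)) + ρ / 2 * ‖p (x k w) - x k w‖ ^ 2 + Λ) ∂P)
      + ENNReal.ofReal (ρ / 2 * (3 * (σ ^ 2 / α ^ 2 + 1 + Lω ^ 2 / α ^ 2) /
        (((k : ℝ) + 1) ^ ζ) ^ 2)) * P s := by
  set t : ℝ := ((k : ℝ) + 1) ^ ζ with ht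
  have ht0 : 0 < t := by positivity
  have hρ0 : 0 < ρ := by linarith
  set wt : E → S → ℝ := fun y b => ρ + κ + τ + max (Lip y b : ℝ) α * t with hwt
  have hwtκ : ∀ y b, κ < wt y b := fun y b => by
    have : 0 < max (Lip y b : ℝ) α * t := mul_pos (hα.trans_le (le_max_right _ _)) ht0
    simp only [hwt]
    linarith
  -- This bound depends on the current anchor and the fresh pair alone, not on the next iterate, so
  -- the pair can be integrated out by the freezing lemma.
  set B : E × (S × S) → ℝ := fun z => h (p z.1) + ρ / (wt z.1 z.2.2 - κ) *
    stepBound (wt z.1 z.2.2) ‖p z.1 - z.1‖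
      (m z.1 (p z.1) z.2.1 - m z.1 z.1 z.2.1 + ((ω (p z.1)).toReal - (ω z.1).toReal))
      (Lip z.1 z.2.1 + Lω) + Λ with hB
  have hpm : Measurable p := hpc.measurable
  have hrm : Measurable fun y : E => ‖p y - y‖ := (hpc.sub continuous_id).norm.measurable
  -- No measurability of `h` is assumed; that of `h ∘ p` follows by subtracting a quadratic from the
  -- continuous envelope.
  have hhp : Measurable fun y : E => h (p y) := by
    have : (fun y : E => h (p y)) = fun y =>
        (h (p y) + ρ / 2 * ‖p y - y‖ ^ 2) - ρ / 2 * ‖p y - y‖ ^ 2 := by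
      funext y
      ring
    rw [this]
    exact hΦ.measurable.sub ((hrm.pow_const 2).const_mul _)
  have hwm : Measurable fun y : E => (ω y).toReal := hω_meas.ereal_toReal
  have hBm : Measurable B := by
    have h1 : Measurable fun z : E × (S × S) => wt z.1 z.2.2 := by
      have : Measurable fun z : E × (S × S) => (Lip z.1 z.2.2 : ℝ) :=
        (hLip_meas.comp (measurable_fst.prodMk measurable_snd.snd)).coe_nnreal_real
      simp only [hwt]
      fun_prop
    have h2 : Measurable fun z : E × (S × S) => (Lip z.1 z.2.1 : ℝ) :=
      (hLip_meas.comp (measurable_fst.prodMk measurable_snd.fst)).coe_nnreal_real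
    have h3 : Measurable fun z : E × (S × S) => m z.1 (p z.1) z.2.1 :=
      hm_meas.comp (measurable_fst.prodMk ((hpm.comp measurable_fst).prodMk measurable_snd.fst))
    have h4 : Measurable fun z : E × (S × S) => m z.1 z.1 z.2.1 :=
      hm_meas.comp (measurable_fst.prodMk (measurable_fst.prodMk measurable_snd.fst))
    have h5 : Measurable fun z : E × (S × S) => h (p z.1) := hhp.comp measurable_fst
    have h6 : Measurable fun z : E × (S × S) => ‖p z.1 - z.1‖ := hrm.comp measurable_fst
    have h7 : Measurable fun z : E × (S × S) => (ω (p z.1)).toReal :=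
      (hwm.comp hpm).comp measurable_fst
    have h8 : Measurable fun z : E × (S × S) => (ω z.1).toReal := hwm.comp measurable_fst
    exact (h5.add ((measurable_const.div (h1.sub_const κ)).mul
      ((((h1.div_const 2).mul (h6.pow_const 2)).add ((h3.sub h4).add (h7.sub h8))).add
        (((h2.add_const _).pow_const 2).div (h1.const_mul 2))))).add_const Λ
  have hmem := hx.ae_mem_effDom hbot hx₁
  have hconv : ∀ᵐ w ∂P, ∀ y ∈ effDom ω, ConvexOn ℝ (effDom ω) (fun z => m y z (ξ k w)) := by
    have h1 := hm.convex
    rw [← hξ.law k] at h1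
    exact ae_of_ae_map (hξ.measurable k).aemeasurable h1
  have hlip : ∀ᵐ w ∂P, ∀ y ∈ effDom ω, LipschitzWith (Lip y (ξ k w)) (fun z => m y z (ξ k w)) := by
    have h1 := hLip.lipschitz
    rw [← hξ.law k] at h1
    exact ae_of_ae_map (hξ.measurable k).aemeasurable h1
  have hstep : ∀ᵐ w ∂P, h (p (x (k + 1) w)) + ρ / 2 * ‖p (x (k + 1) w) - x (k + 1) w‖ ^ 2 + Λ
      ≤ B (x k w, ξ k w, ξ' k w) := by
    filter_upwards [hx.step, hmem, hconv, hlip] with w hw hwD hwc hwl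
    have := envelope_step_le (γ := wt (x k w) (ξ' k w)) hp hρ0.le (hwtκ _ _)
      (hκ.trans_lt (hwtκ _ _)) hω hω_lip
      (hwc _ (hwD k)) (hwl _ (hwD k)) (hwD k) (hwD (k + 1)) fun y hy => (hw k).le hbot hy
    simp only [hB]
    linarith
  have hexp : ∀ y ∈ effDom ω,
      (∫⁻ z, ENNReal.ofReal (B (y, z)) ∂(Ξ.prod Ξ))
        + ENNReal.ofReal (ρ * (ρ - κ - τ) * ‖p y - y‖ ^ 2 / (ρ + τ + (G ‖y‖₊ + α) * t)) ≤
      ENNReal.ofReal (h (p y) + ρ / 2 * ‖p y - y‖ ^ 2 + Λ)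
        + ENNReal.ofReal (ρ / 2 * (3 * (σ ^ 2 / α ^ 2 + 1 + Lω ^ 2 / α ^ 2) / t ^ 2)) := by
    intro y hy
    subst hh
    exact lintegral_modelStep_le hκ hτ hρ hα ht0 hω hω_lip hm hLip hy
      (hLip_meas.comp measurable_prodMk_left) (hG y hy) (hp y).1 (hp y).2 (hlow _ (hp y).1)
  have hmeas : Measurable fun z => ENNReal.ofReal (B z) := hBm.ennreal_ofReal
  have hF : pastSigma ξ ξ' k ≤ _ := hξ.filtration.le k
  have hxm : Measurable (x k) := (hx.adapted k).mono hF le_rfl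
  have hVm : Measurable fun w =>
      ENNReal.ofReal (h (p (x k w)) + ρ / 2 * ‖p (x k w) - x k w‖ ^ 2 + Λ) :=
    ((hΦ.measurable.comp hxm).add_const Λ).ennreal_ofReal
  have hfreeze := setLIntegral_comp_of_indep hF (hx.adapted k)
    ((hξ.measurable k).prodMk (hξ.measurable' k)) (hξ.indep_pastSigma k) hs hmeas
  rw [hξ.map_prodMk k] at hfreeze
  have hIm : Measurable fun w => ∫⁻ z, ENNReal.ofReal (B (x k w, z)) ∂(Ξ.prod Ξ) :=
    hmeas.lintegral_prod_right'.comp hxm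
  calc _ ≤ (∫⁻ w in s, ENNReal.ofReal (B (x k w, ξ k w, ξ' k w)) ∂P) + _ :=
        add_le_add (lintegral_mono_ae (ae_restrict_of_ae (hstep.mono fun w hw =>
          ENNReal.ofReal_le_ofReal hw))) le_rfl
    _ = ∫⁻ w in s, ((∫⁻ z, ENNReal.ofReal (B (x k w, z)) ∂(Ξ.prod Ξ)) +
          ENNReal.ofReal (ρ * (ρ - κ - τ) * ‖p (x k w) - x k w‖ ^ 2 /
            (ρ + τ + (G ‖x k w‖₊ + α) * t))) ∂P := by
        rw [hfreeze, lintegral_add_left hIm]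
    _ ≤ ∫⁻ w in s, (ENNReal.ofReal (h (p (x k w)) + ρ / 2 * ‖p (x k w) - x k w‖ ^ 2 + Λ) +
          ENNReal.ofReal (ρ / 2 * (3 * (σ ^ 2 / α ^ 2 + 1 + Lω ^ 2 / α ^ 2) / t ^ 2))) ∂P :=
        lintegral_mono_ae (ae_restrict_of_ae (hmem.mono fun w hw => hexp _ (hw k)))
    _ = _ := by
        rw [lintegral_add_left hVm, setLIntegral_const]

end Run

end StochasticModel

open StochasticModel

theorem theorem5p1 (n : ℕ)
    {S : Type*} [MeasurableSpace S] (Ξ : Measure S) [IsProbabilityMeasure Ξ]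
    {Ω : Type*} [MeasurableSpace Ω] (P : Measure Ω) [IsProbabilityMeasure P]
    -- the problem: `ψ = 𝔼 F + ω`, with `ω` weakly convex and Lipschitz on its domain
    (F : EuclideanSpace ℝ (Fin n) → S → ℝ) (ω : EuclideanSpace ℝ (Fin n) → EReal)
    (κ τ ρ Λ α σ ζ : ℝ) (Lω : ℝ≥0) (hκ : 0 ≤ κ) (hτ : 0 ≤ τ) (hρ : κ + τ < ρ) (hΛ : 0 ≤ Λ)
    (hα : 0 < α) (hζ : ζ ∈ Set.Ioo (1 / 2 : ℝ) 1)
    (hω_lsc : LowerSemicontinuous ω)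
    (hω_wc : StochasticModel.IsWeaklyConvex κ ω)
    (hω_lip : LipschitzOnWith Lω (fun x => (ω x).toReal) (StochasticModel.effDom ω))
    -- the stochastic model and its reference Lipschitz continuity
    (m : EuclideanSpace ℝ (Fin n) → EuclideanSpace ℝ (Fin n) → S → ℝ)
    (hm_meas : Measurable
      (fun p : EuclideanSpace ℝ (Fin n) × EuclideanSpace ℝ (Fin n) × S => m p.1 p.2.1 p.2.2))
    (hm : StochasticModel.IsStochasticModel Ξ F (StochasticModel.effDom ω) τ m)
    (Lip : EuclideanSpace ℝ (Fin n) → S → ℝ≥0)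
    (hLip_meas : Measurable (fun p : EuclideanSpace ℝ (Fin n) × S => Lip p.1 p.2))
    (hLip : StochasticModel.IsReferenceLipschitz Ξ (StochasticModel.effDom ω) m Lip σ)
    -- the expected Lipschitz constant is controlled by some (unknown) growth function
    (hgrowth : ∃ G : ℝ≥0 → ℝ≥0, StochasticModel.IsGrowthFunction G ∧
      ∀ x ∈ StochasticModel.effDom ω, ∫ ξ, (Lip x ξ : ℝ) ∂Ξ ≤ (G ‖x‖₊ : ℝ))
    -- the Moreau envelope is bounded below, and its level sets are bounded
    (hlower : ∀ x, ((-Λ : ℝ) : EReal) ≤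
      StochasticModel.moreauEnvelope (StochasticModel.objective Ξ F ω) ρ x)
    (hlevel : ∀ v : ℝ, Bornology.IsBounded
      {x | StochasticModel.moreauEnvelope (StochasticModel.objective Ξ F ω) ρ x ≤ (v : EReal)})
    -- the samples and the run of the algorithm
    (ξ ξ' : ℕ → Ω → S) (hξ : StochasticModel.IsSampling P Ξ ξ ξ')
    (x₁ : EuclideanSpace ℝ (Fin n)) (hx₁ : x₁ ∈ StochasticModel.effDom ω)
    (x : ℕ → Ω → EuclideanSpace ℝ (Fin n))
    (hx : StochasticModel.IsModelBasedRun P m ω ξ ξ'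
      (fun k w => ρ + κ + τ + max (Lip (x k w) (ξ' k w) : ℝ) α * ((k : ℝ) + 1) ^ ζ) x₁ x) :
    Differentiable ℝ (StochasticModel.moreauReal (StochasticModel.objective Ξ F ω) ρ) ∧
    (∀ᵐ w ∂P, ∃ R : ℝ, ∀ k, ‖x k w‖ ≤ R) ∧
    (∀ᵐ w ∂P, Tendsto (fun k : ℕ => ⨅ j : Set.Iic k,
      ‖gradient (StochasticModel.moreauReal (StochasticModel.objective Ξ F ω) ρ) (x j w)‖)
      atTop (𝓝 0)) := by
  obtain ⟨G, ⟨hGc, hGm⟩, hG⟩ := hgrowth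
  have hρ0 : 0 < ρ := by linarith
  have hbot := hω_wc.1
  have hD : Convex ℝ (effDom ω) := hω_wc.2.1
  have hω : StrongConvexOn (effDom ω) (-κ) fun y => (ω y).toReal := by
    rw [strongConvexOn_iff_convex]
    convert hω_wc.2 using 2
    ring
  have hclosed := isClosed_effDom hω_lsc hbot hω_lip
  have hint : ∀ y ∈ effDom ω, Integrable (fun ξ => (Lip y ξ : ℝ)) Ξ := fun y hy =>
    hLip.integrable_lip hy (hLip_meas.comp measurable_prodMk_left)
  have hh : StrongConvexOn (effDom ω) (-τ + -κ) fun y => ∫ ξ, F y ξ ∂Ξ + (ω y).toReal :=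
    strongConvexOn_add (hm.strongConvexOn hD) hω
  -- The envelope minorizes `ψ`, so its lower bound passes to `ψ`.
  have hlow : ∀ y ∈ effDom ω, -Λ ≤ ∫ ξ, F y ξ ∂Ξ + (ω y).toReal := fun y hy => by
    have := (hlower y).trans (moreauEnvelope_le_self _ ρ y)
    rwa [objective_eq_coe hbot hy, EReal.coe_le_coe_iff] at this
  obtain ⟨p, hp⟩ := exists_isProxMap hclosed ⟨x₁, hx₁⟩
    ((hm.continuousOn_obj hLip hint hGc hG).add hω_lip.continuousOn) hlow hρ0
  have hc : 0 < -τ + -κ + ρ := by linarith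
  have hpc : Continuous p := hp.continuous hh hc hρ0.le
  have henv := moreauEnvelope_eq (fun y hy => objective_eq_coe (Ξ := Ξ) (F := F) hbot hy)
    (fun y hy => objective_eq_top hy) hp
  set φ : EuclideanSpace ℝ (Fin n) → ℝ := fun y =>
    ∫ ξ, F (p y) ξ ∂Ξ + (ω (p y)).toReal + ρ / 2 * ‖p y - y‖ ^ 2 with hφ
  have hφeq : moreauReal (objective Ξ F ω) ρ = φ := by
    funext y
    rw [moreauReal, henv y, EReal.toReal_coe]
  have hgrad : ∀ y, HasGradientAt φ (ρ • (y - p y)) y := fun y => hp.hasGradientAt hh hc hρ0.le y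
  have hdiff : Differentiable ℝ φ := fun y => (hgrad y).differentiableAt
  have hφlow : ∀ y, 0 ≤ φ y + Λ := fun y => by
    have := hlower y
    rw [henv y, EReal.coe_le_coe_iff] at this
    simp only [hφ]
    linarith
  set A : ℕ → Ω → ℝ := fun k w => ρ * (ρ - κ - τ) * ‖p (x k w) - x k w‖ ^ 2 /
    (ρ + τ + (G ‖x k w‖₊ + α) * ((k : ℝ) + 1) ^ ζ) with hA
  have hden : ∀ (k : ℕ) (y : EuclideanSpace ℝ (Fin n)),
      0 < ρ + τ + (G ‖y‖₊ + α) * ((k : ℝ) + 1) ^ ζ := fun k y => by positivity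
  have ha : 0 < ρ * (ρ - κ - τ) := mul_pos hρ0 (by linarith)
  -- The lower bound `1 / 2 < ζ` enters here: the errors are of order `(k + 1) ^ (-2ζ)`.
  have hsumc : Summable fun k : ℕ => ρ / 2 *
      (3 * (σ ^ 2 / α ^ 2 + 1 + (Lω : ℝ) ^ 2 / α ^ 2) / (((k : ℝ) + 1) ^ ζ) ^ 2) := by
    have h1 : Summable fun k : ℕ => 1 / ((k + 1 : ℕ) : ℝ) ^ (ζ * 2) :=
      (summable_nat_add_iff (f := fun k : ℕ => 1 / (k : ℝ) ^ (ζ * 2)) 1).2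
        (Real.summable_one_div_nat_rpow.2 (by linarith [hζ.1]))
    refine (h1.mul_left (ρ / 2 * (3 * (σ ^ 2 / α ^ 2 + 1 + (Lω : ℝ) ^ 2 / α ^ 2)))).congr
      fun k => ?_
    rw [Real.rpow_mul (by positivity), Real.rpow_two]
    push_cast
    ring
  have hxad : ∀ k, Measurable[hξ.filtration k] (x k) := hx.adapted
  have hRS := ae_bddAbove_and_summable_of_almost_supermartingale (P := P) (ℱ := hξ.filtration)
    (V := fun k w => φ (x k w) + Λ) (A := A) (fun k w => hφlow _)
    (fun k w => by
      have := hden k (x k w)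
      simp only [hA]
      positivity)
    (fun k => by positivity) hsumc
    (fun k => ((hdiff.continuous.measurable.comp (hxad k)).add_const Λ).stronglyMeasurable)
    (fun k => by
      have h1 : Measurable fun y : EuclideanSpace ℝ (Fin n) => ρ * (ρ - κ - τ) * ‖p y - y‖ ^ 2 /
          (ρ + τ + (G ‖y‖₊ + α) * ((k : ℝ) + 1) ^ ζ) := by
        have h2 : Continuous fun y : EuclideanSpace ℝ (Fin n) =>
            ρ * (ρ - κ - τ) * ‖p y - y‖ ^ 2 := by fun_prop
        have h3 : Continuous fun y : EuclideanSpace ℝ (Fin n) =>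
            ρ + τ + (G ‖y‖₊ + α) * ((k : ℝ) + 1) ^ ζ := by fun_prop
        exact h2.measurable.div h3.measurable
      exact (h1.comp (hxad k)).stronglyMeasurable)
    (by
      simp only [hx.init]
      exact integrable_const _)
    (fun k s hs => setLIntegral_envelope_step_le hκ hτ hρ hα hbot hω_lsc.measurable hω hω_lip
      hm_meas hm hLip_meas hLip hG rfl hp hpc hdiff.continuous hlow hξ hx₁ hx k hs)
  have hbdd : ∀ᵐ w ∂P, ∃ R : ℝ, ∀ k, ‖x k w‖ ≤ R := by
    filter_upwards [hRS] with w hw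
    obtain ⟨v, hv⟩ := hw.1
    obtain ⟨R, hR⟩ := (hlevel (v - Λ)).exists_norm_le
    refine ⟨R, fun k => hR _ ?_⟩
    have h1 : φ (x k w) + Λ ≤ v := hv ⟨k, rfl⟩
    rw [Set.mem_ofPred_eq, henv, EReal.coe_le_coe_iff]
    simp only [hφ] at h1
    linarith
  refine ⟨hφeq ▸ hdiff, hbdd, ?_⟩
  filter_upwards [hRS, hbdd] with w hw ⟨R, hR⟩
  refine tendsto_iInf_Iic_zero (u := fun j => ‖gradient (moreauReal (objective Ξ F ω) ρ) (x j w)‖)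
    (fun k => norm_nonneg _) fun ε hε => ?_
  -- On a bounded path the monotone growth function is at most its value at `R`, so the denominators
  -- are of order `(k + 1) ^ ζ` with a constant depending on the path.
  have hM : ∀ k : ℕ, ρ + τ + (G ‖x k w‖₊ + α) * ((k : ℝ) + 1) ^ ζ ≤
      (ρ + τ + (G R.toNNReal + α)) * ((k : ℝ) + 1) ^ ζ := fun k => by
    have h1 : (1 : ℝ) ≤ ((k : ℝ) + 1) ^ ζ :=
      Real.one_le_rpow (by linarith [k.cast_nonneg (α := ℝ)]) (by linarith [hζ.1])
    have h2 : (G ‖x k w‖₊ : ℝ) ≤ G R.toNNReal :=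
      NNReal.coe_le_coe.2 (hGm (by
        rw [← NNReal.coe_le_coe, coe_nnnorm]
        exact (hR k).trans (Real.le_coe_toNNReal R)))
    have h3 : ρ + τ ≤ (ρ + τ) * ((k : ℝ) + 1) ^ ζ :=
      le_mul_of_one_le_right (by linarith) h1
    rw [add_mul (ρ + τ)]
    gcongr
  -- The threshold is `ε / ρ` because the gradient has norm `ρ ‖p x - x‖`.
  obtain ⟨k, hk⟩ := exists_lt_of_summable_div ha hζ.2.le (fun k => hden k (x k w)) hM hw.2
    (div_pos hε hρ0)
  refine ⟨k, ?_⟩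
  rw [hφeq, (hgrad _).gradient, norm_smul, Real.norm_of_nonneg hρ0.le, norm_sub_rev]
  rwa [lt_div_iff₀' hρ0] at hk
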